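/- Let $C$ be a compact connected oriented 1-manifold with universal cover $\widetilde C$, and let $\kappa$ be the orientation preserving diffeomorphism of $\widetilde C$ generating the deck group $\mathbb Z$ (with $\kappa(x)$ on the positive side of $x$), so that $C=\widetilde C/\mathbb Z$. Write $|\Omega|^r$ for the space of smooth $r$-densities on $\widetilde C$ (so $|\Omega|^{-1}$ is the space of vector fields); $\kappa^*$ denotes pull-back of densities. In a global oriented coordinate $x$ on $\widetilde C$, densities are identified with functions and $'$ denotes $\partial/\partial x$. All products of 1-forms are wedge products, with $(\alpha\wedge\beta)(V,W)=\alpha(V)\beta(W)-\alpha(W)\beta(V)$. *Developing maps.* $\mathcal D(C)$ is the space of orientation preserving local diffeomorphisms $\gamma\colon\widetilde C\to\mathbb{RP}^1$ such that $\gamma(\kappa(x))=h\cdot\gamma(x)$ for all $x$, for some $h\in\mathrm{PSL}(2,\mathbb R)$; here $\mathbb{RP}^1=\{(\sin\phi:\cos\phi)\}$ is oriented by $\phi$. A normalized lift of $\gamma$ is a pair $u_1,u_2\in|\Omega|^{-1/2}$ with $\gamma=(u_1:u_2)$ and Wronskian $u_1u_2'-u_2u_1'=-1$; it exists and is unique up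 to an overall sign. The Hill operator $L=p(\gamma)$, $Lu=u''+\mathcal Tu$, is the one with $Lu_1=Lu_2=0$. Put, for vector fields $v,w$, $$-D_Lv=\mathcal T'v+2\mathcal Tv'+\tfrac12v''',\qquad B_{L,x}(v,w)=\Big(2\mathcal Tvw+\tfrac12(v''w-v'w'+vw'')\Big)\Big|_x .$$ Tangent vectors of $\mathcal D(C)$ are velocities at $t=0$ of curves $t\mapsto\gamma_t\in\mathcal D(C)$ that are jointly smooth in $t$ and $x$. Let $\Theta\in\Omega^1(\mathcal D(C),|\Omega|^{-1})$ be minus the map $T_\gamma\mathcal D(C)\to\Gamma(\gamma^*T\mathbb{RP}^1)\cong\Gamma(T\widetilde C)$, that is, $\Theta=-\mathrm d\phi/\phi'$ for $\gamma=(\sin\phi:\cos\phi)$. For $x_0\in\widetilde C$ define $$\varpi_{\mathcal D}=\int_{x_0}^{\kappa(x_0)}(D_L\Theta)\,\Theta+B_{L,x_0}(\Theta,\kappa^*\Theta)\in\Omega^2(\mathcal D(C)).$$ *Quasi-periodic sections.* Let $E=J^1(|\Lambda|^{-1/2}_C)$ be the bundle of 1-jets of $-\frac12$-densities on $C$, with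 the $\mathrm{SL}(2,\mathbb R)$-frames $(j^1_x(u_1),j^1_x(u_2))$ for $u_1,u_2$ with Wronskian $-1$, and let $Q\to C$ be the principal $G=\mathrm{PSL}(2,\mathbb R)$-bundle of these frames modulo sign. With $\pi\colon\widetilde C\to C$ the covering, let $\mathcal P(Q)$ be the space of smooth sections $\tau$ of $\pi^*Q$ such that $\kappa^*\tau=h\cdot\tau:=\tau h^{-1}$ for some $h=:q(\tau)\in G$. Tangent vectors are again velocities of smooth curves. Let $\Xi_x\in\Omega^1(\mathcal P(Q),\mathfrak{sl}(2,\mathbb R))$ be the pull-back under $\tau\mapsto\tau(x)$ of the unique connection form of the fibre $Q_{\pi(x)}$ (so $\Xi_x=\tau(x)^{-1}\mathrm d\tau(x)$ in a trivialization of the fibre), let $\theta^L$ be the left Maurer-Cartan form of $G$, and let $\langle X,Y\rangle=2\operatorname{tr}(XY)$. For $x_1\in\widetilde C$ define $$\varpi_{\mathcal P}=-\tfrac12\int_{x_1}^{\kappa(x_1)}\langle\Xi,\Xi'\rangle+\tfrac12\langle\Xi_{x_1},q^*\theta^L\rangle\in\Omega^2(\mathcal P(Q)).$$ *The embedding.*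 $\widehat\iota\colon\mathcal D(C)\to\mathcal P(Q)$ sends $\gamma$ to the section whose value at $x$ is the class of the frame $(j^1_x(u_1),j^1_x(u_2))$ of its normalized lift. **Theorem.** The map $\widehat\iota$ takes smooth curves to smooth curves, and for all choices of the base points $x_0,x_1$ one has $$\varpi_{\mathcal D}=\widehat\iota^{\,*}\varpi_{\mathcal P}.$$ -/

import Mathlib

open scoped LinearAlgebra.Projectivization ContDiff Topology

noncomputable section

namespace DrinfeldSokolov

/-! ### The real projective line and the projective special linear group -/

/-- The real projective line; the point `(a : b)` is the line spanned by `![a, b]`. -/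
abbrev RP1 : Type := ℙ ℝ (Fin 2 → ℝ)

/-- `SL(2, ℝ)`. -/
abbrev SL2 : Type := Matrix.SpecialLinearGroup (Fin 2) ℝ

/-- `PSL(2, ℝ) = SL(2, ℝ) / {± 1}`, with its Mathlib action on `RP1`. -/
abbrev PSL2 : Type := Matrix.ProjectiveSpecialLinearGroup (Fin 2) ℝ

/-- The standard diffeomorphism of the projective line onto the unit circle of `ℂ`,
`(sin φ : cos φ) ↦ exp (2 i φ)`; it carries the smooth structure of `RP1`. -/
def toCircle (p : RP1) : ℂ :=
  ((p.rep 1 : ℂ) + (p.rep 0 : ℂ) * Complex.I) ^ 2 /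
    (((p.rep 0) ^ 2 + (p.rep 1) ^ 2 : ℝ) : ℂ)

/-- A map to the projective line is smooth. -/
def SmoothToRP1 {N : Type*} [NormedAddCommGroup N] [NormedSpace ℝ N] (f : N → RP1) : Prop :=
  ContDiff ℝ ∞ (fun y => toCircle (f y))

/-- The velocity of a curve `σ = (sin φ : cos φ)` in the projective line at the parameter `s`,
as the coefficient `φ'(s)` of the vector field `∂/∂φ`. (If `z = exp (2 i φ)`, then
`conj z * z' = 2 i φ'`, so no choice of the angle `φ` is involved.) -/
def angularVelocity (σ : ℝ → RP1) (s : ℝ) : ℝ :=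
  (1 / 2) * ((starRingEnd ℂ) (toCircle (σ s)) * deriv (fun r => toCircle (σ r)) s).im

/-- A map to `PSL(2, ℝ)` is smooth: it lifts, locally, to smooth maps to `SL(2, ℝ)`. -/
def SmoothToPSL2 {N : Type*} [NormedAddCommGroup N] [NormedSpace ℝ N] (τ : N → PSL2) : Prop :=
  ∀ p, ∃ g : N → SL2, (∀ i j, ContDiffAt ℝ ∞ (fun y => (g y : Matrix (Fin 2) (Fin 2) ℝ) i j) p) ∧
    ∀ᶠ y in 𝓝 p, τ y = (g y : PSL2)

/-- The curve `g` in `SL(2, ℝ)` is a lift near `t = 0` of the curve `c` in `PSL(2, ℝ)`,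
differentiable at `t = 0`. -/
def IsLiftAtZero (c : ℝ → PSL2) (g : ℝ → SL2) : Prop :=
  (∀ i j, DifferentiableAt ℝ (fun t => (g t : Matrix (Fin 2) (Fin 2) ℝ) i j) 0) ∧
    ∀ᶠ t in 𝓝 (0 : ℝ), c t = (g t : PSL2)

/-- `g(0)⁻¹ (dg/dt)(0)`. -/
def logDerivAtZero (g : ℝ → SL2) : Matrix (Fin 2) (Fin 2) ℝ :=
  (((g 0)⁻¹ : SL2) : Matrix (Fin 2) (Fin 2) ℝ) *
    Matrix.of fun i j => deriv (fun t => (g t : Matrix (Fin 2) (Fin 2) ℝ) i j) 0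

open Classical in
/-- The left-invariant Maurer-Cartan form `θ^L` of `PSL(2, ℝ)` on the velocity at `t = 0` of a
curve `c` in `PSL(2, ℝ)`, an element of `sl(2, ℝ)`. It is computed in any lift of `c` to
`SL(2, ℝ)`, see `maurerCartan_eq`. -/
def maurerCartan (c : ℝ → PSL2) : Matrix (Fin 2) (Fin 2) ℝ :=
  if h : ∃ g, IsLiftAtZero c g then logDerivAtZero h.choose else 0

/-- The metric `⟨X, Y⟩ = 2 tr (X Y)` on `sl(2, ℝ)`. -/
def metric (X Y : Matrix (Fin 2) (Fin 2) ℝ) : ℝ := 2 * (X * Y).trace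

/-! ### The covering space and densities

The universal cover of the circle `C` is the oriented line `ℝ`; the generator of the group of
deck transformations is an arbitrary orientation preserving diffeomorphism `κ` of `ℝ` that moves
every point in the positive direction, and `C = ℝ / κ^ℤ`. An `r`-density `f |dx|^r` on `ℝ` is given
by its coefficient function `f : ℝ → ℝ`. -/

/-- An orientation preserving diffeomorphism of `ℝ` with `x < κ x` for all `x`. -/
structure Deck where
  /-- the underlying map -/
  toFun : ℝ → ℝ
  smooth : ContDiff ℝ ∞ toFun
  deriv_pos : ∀ x, 0 < deriv toFun x
  surjective : Function.Surjective toFun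
  lt_apply : ∀ x, x < toFun x

instance : CoeFun Deck (fun _ => ℝ → ℝ) := ⟨Deck.toFun⟩

/-- The pull-back `κ^* f` of an `r`-density. -/
def Deck.pullback (κ : Deck) (r : ℝ) (f : ℝ → ℝ) (x : ℝ) : ℝ :=
  (deriv κ x) ^ r * f (κ x)

/-- The `1`-jet at `x` of a `-1/2`-density `u`, in the trivialization `j¹_x(u) ↦ (u'(x), u(x))` of
the jet bundle `J¹(|Λ|^{-1/2})`. -/
def jet (u : ℝ → ℝ) (x : ℝ) : Fin 2 → ℝ := ![deriv u x, u x]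

/-- The map from the jets at `κ x` to the jets at `x` induced by the pull-back of
`-1/2`-densities, see `jet_pullback`. -/
def Deck.jetMap (κ : Deck) (x : ℝ) : SL2 :=
  ⟨!![(deriv κ x) ^ (1 / 2 : ℝ), -(1 / 2) * deriv (deriv κ) x * (deriv κ x) ^ (-(3 / 2) : ℝ);
      0, (deriv κ x) ^ (-(1 / 2) : ℝ)], by
    rw [Matrix.det_fin_two_of, ← Real.rpow_add (κ.deriv_pos x)]
    norm_num⟩

/-- The Wronskian of two `-1/2`-densities. -/
def wronskian (u₁ u₂ : ℝ → ℝ) (x : ℝ) : ℝ := u₁ x * deriv u₂ x - u₂ x * deriv u₁ x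

/-- The Lie derivative of an `r`-density `f` along the vector field `v ∂/∂x`. -/
def lieDeriv (r : ℝ) (v f : ℝ → ℝ) (x : ℝ) : ℝ := v x * deriv f x + r * deriv v x * f x

/-- The Hill operator with Hill potential `T`, from `-1/2`-densities to `3/2`-densities. -/
def hill (T u : ℝ → ℝ) (x : ℝ) : ℝ := iteratedDeriv 2 u x + T x * u x

/-- The operator `D_L`, for the Hill operator `L` with potential `T`, from vector fields to quadratic
differentials: multiplication by `- D_L v` is the commutator `[ℒ_v, L]`, see
`lieDeriv_hill_sub`. -/
def hillD (T v : ℝ → ℝ) (x : ℝ) : ℝ :=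
  -(deriv T x * v x + 2 * T x * deriv v x + (1 / 2) * iteratedDeriv 3 v x)

/-- The bilinear concomitant `B_{L, x}` on `2`-jets of vector fields: the form for which the
derivative of `x ↦ B_{L, x}(v, w)` is `- ((D_L v) w + v (D_L w))`, see
`hasDerivAt_concomitant`. -/
def concomitant (T : ℝ → ℝ) (x : ℝ) (v w : ℝ → ℝ) : ℝ :=
  2 * T x * v x * w x +
    (1 / 2) * (iteratedDeriv 2 v x * w x - deriv v x * deriv w x + v x * iteratedDeriv 2 w x)

/-! ### Developing maps -/

/-- The space `𝒟(C)` of developing maps: orientation preserving local diffeomorphisms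
`γ : ℝ → RP1` with `γ (κ x) = h • γ x` for some `h` in `PSL(2, ℝ)`. -/
structure DevelopingMap (κ : Deck) where
  /-- the underlying map -/
  toFun : ℝ → RP1
  smooth : SmoothToRP1 toFun
  orientation : ∀ x, 0 < angularVelocity toFun x
  quasiPeriodic : ∃ h : PSL2, ∀ x, toFun (κ x) = h • toFun x

instance (κ : Deck) : CoeFun (DevelopingMap κ) (fun _ => ℝ → RP1) := ⟨DevelopingMap.toFun⟩

/-- `(u₁, u₂)` is a normalized lift of `γ`: a pair of smooth `-1/2`-densities with Wronskian
`-1` and `γ = (u₁ : u₂)`. -/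
structure IsNormalizedLift (γ : ℝ → RP1) (u₁ u₂ : ℝ → ℝ) : Prop where
  smooth₁ : ContDiff ℝ ∞ u₁
  smooth₂ : ContDiff ℝ ∞ u₂
  wronskian_eq : ∀ x, wronskian u₁ u₂ x = -1
  eq_mk : ∀ x, ∃ h : ![u₁ x, u₂ x] ≠ 0, γ x = Projectivization.mk ℝ ![u₁ x, u₂ x] h

/-! ### Facts behind the definitions -/

theorem toCircle_mk (a b : ℝ) (h : ![a, b] ≠ 0) :
    toCircle (Projectivization.mk ℝ ![a, b] h) =
      ((b : ℂ) + (a : ℂ) * Complex.I) ^ 2 / ((a ^ 2 + b ^ 2 : ℝ) : ℂ) := by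
  obtain ⟨c, hc⟩ := Projectivization.exists_smul_eq_mk_rep ℝ ![a, b] h
  have h0 : (Projectivization.mk ℝ ![a, b] h).rep 0 = c * a := by
    rw [← hc]; simp [Units.smul_def]
  have h1 : (Projectivization.mk ℝ ![a, b] h).rep 1 = c * b := by
    rw [← hc]; simp [Units.smul_def]
  have hcne : ((c : ℝ) : ℂ) ≠ 0 := by exact_mod_cast c.ne_zero
  unfold toCircle
  rw [h0, h1]
  push_cast
  rw [show ((c : ℝ) : ℂ) * b + (c : ℝ) * a * Complex.I = (c : ℝ) * (b + a * Complex.I) by ring,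
    show (((c : ℝ) : ℂ) * a) ^ 2 + ((c : ℝ) * b) ^ 2 = ((c : ℝ) : ℂ) ^ 2 * (a ^ 2 + b ^ 2) by ring,
    mul_pow, mul_div_mul_left _ _ (pow_ne_zero 2 hcne)]

theorem sin_cos_ne_zero (φ : ℝ) : ![Real.sin φ, Real.cos φ] ≠ 0 := by
  intro h
  have h0 := congrFun h 0
  have h1 := congrFun h 1
  simp at h0 h1
  have := Real.sin_sq_add_cos_sq φ
  rw [h0, h1] at this
  norm_num at this

theorem toCircle_sin_cos (φ : ℝ) :
    toCircle (Projectivization.mk ℝ ![Real.sin φ, Real.cos φ] (sin_cos_ne_zero φ)) =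
      Complex.exp (2 * φ * Complex.I) := by
  rw [toCircle_mk, Real.sin_sq_add_cos_sq]
  push_cast
  rw [← Complex.exp_mul_I, ← Complex.exp_nat_mul]
  push_cast
  rw [div_one]
  ring_nf

theorem exists_pair (p : RP1) : ∃ a b : ℝ, ∃ h : ![a, b] ≠ 0, p = Projectivization.mk ℝ ![a, b] h := by
  have e : p.rep = ![p.rep 0, p.rep 1] := by ext i; fin_cases i <;> rfl
  have h : ![p.rep 0, p.rep 1] ≠ 0 := by rw [← e]; exact p.rep_nonzero
  refine ⟨p.rep 0, p.rep 1, h, ?_⟩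
  conv_lhs => rw [← p.mk_rep]
  congr 1

theorem sq_add_sq_pos {a b : ℝ} (h : ![a, b] ≠ 0) : 0 < a ^ 2 + b ^ 2 := by
  by_contra hn
  have ha : a = 0 := by nlinarith [sq_nonneg a, sq_nonneg b]
  have hb : b = 0 := by nlinarith [sq_nonneg a, sq_nonneg b]
  exact h (by simp [ha, hb])

theorem conj_mul_toCircle (p : RP1) : (starRingEnd ℂ) (toCircle p) * toCircle p = 1 := by
  obtain ⟨a, b, h, rfl⟩ := exists_pair p
  have hpos := sq_add_sq_pos h
  have hne : ((a : ℂ) ^ 2 + (b : ℂ) ^ 2) ≠ 0 := by exact_mod_cast hpos.ne'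
  rw [toCircle_mk]
  simp only [map_div₀, map_pow, map_add, map_mul, Complex.conj_ofReal, Complex.conj_I]
  push_cast
  field_simp
  rw [show ((b : ℂ) + -((a : ℂ) * Complex.I)) ^ 2 * (b + a * Complex.I) ^ 2 =
    (b ^ 2 - a ^ 2 * Complex.I ^ 2) ^ 2 by ring, Complex.I_sq]
  ring

theorem eq_mk_of_toCircle_eq (p : RP1) (φ : ℝ)
    (hp : toCircle p = Complex.exp (2 * φ * Complex.I)) :
    p = Projectivization.mk ℝ ![Real.sin φ, Real.cos φ] (sin_cos_ne_zero φ) := by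
  obtain ⟨a, b, h, rfl⟩ := exists_pair p
  have hpos := sq_add_sq_pos h
  rw [← toCircle_sin_cos, toCircle_mk, toCircle_mk, Real.sin_sq_add_cos_sq] at hp
  have hne : ((a : ℂ) ^ 2 + (b : ℂ) ^ 2) ≠ 0 := by exact_mod_cast hpos.ne'
  push_cast at hp
  rw [div_one, div_eq_iff hne] at hp
  have hcs := Real.sin_sq_add_cos_sq φ
  rw [← Complex.ofReal_sin, ← Complex.ofReal_cos] at hp
  set s := Real.sin φ
  set c := Real.cos φ
  have hre := congrArg Complex.re hp
  have him := congrArg Complex.im hp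
  simp [pow_two] at hre him
  -- the real and imaginary parts force `a c = b s`
  have key : (a * c - b * s) ^ 2 = 0 := by
    have e1 : b ^ 2 - a ^ 2 = (c ^ 2 - s ^ 2) * (a ^ 2 + b ^ 2) := by linarith
    have e2 : a * b = c * s * (a ^ 2 + b ^ 2) := by linarith
    have e3 : (a * c - b * s) ^ 2 * 2 =
      (a ^ 2 + b ^ 2) * (s ^ 2 + c ^ 2) - (b ^ 2 - a ^ 2) * (c ^ 2 - s ^ 2) -
        4 * (a * b) * (c * s) := by ring
    rw [e1, e2, hcs] at e3
    have e4 : (c ^ 2 - s ^ 2) ^ 2 + 4 * (c * s) ^ 2 = 1 := by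
      rw [show (c ^ 2 - s ^ 2) ^ 2 + 4 * (c * s) ^ 2 = (s ^ 2 + c ^ 2) ^ 2 by ring, hcs]; norm_num
    nlinarith
  have key' : a * c = b * s := by
    have := pow_eq_zero_iff (two_ne_zero) |>.mp key
    linarith
  rw [Projectivization.mk_eq_mk_iff']
  refine ⟨a * s + b * c, ?_⟩
  ext i
  fin_cases i
  · simp
    linear_combination c * key' * (-1) + a * hcs
  · simp
    linear_combination s * key' + b * hcs

theorem contDiff_angularVelocity {γ : ℝ → RP1} (hγ : SmoothToRP1 γ) :
    ContDiff ℝ ∞ (angularVelocity γ) := by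
  have h1 : ContDiff ℝ ∞ (fun x => toCircle (γ x)) := hγ
  have h2 : ContDiff ℝ ∞ (deriv (fun x => toCircle (γ x))) := (contDiff_infty_iff_deriv.1 h1).2
  have h3 : ContDiff ℝ ∞ (fun x => (starRingEnd ℂ) (toCircle (γ x))) :=
    Complex.conjCLE.contDiff.comp h1
  have h4 := Complex.imCLM.contDiff.comp (h3.mul h2) (n := ∞)
  exact contDiff_const.mul h4

theorem exists_angle {γ : ℝ → RP1} (hγ : SmoothToRP1 γ) :
    ∃ φ : ℝ → ℝ, (∀ x, HasDerivAt φ (angularVelocity γ x) x) ∧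
      ∀ x, γ x = Projectivization.mk ℝ ![Real.sin (φ x), Real.cos (φ x)] (sin_cos_ne_zero _) := by
  set ψ := angularVelocity γ with hψ
  have hψc : Continuous ψ := (contDiff_angularVelocity hγ).continuous
  set z : ℝ → ℂ := fun x => toCircle (γ x) with hz
  have hzd : ∀ x, HasDerivAt z (deriv z x) x := fun x =>
    ((show ContDiff ℝ ∞ z from hγ).differentiable (by simp) x).hasDerivAt
  have hone : ∀ x, (starRingEnd ℂ) (z x) * z x = 1 := fun x => conj_mul_toCircle _
  have hode : ∀ x, deriv z x = 2 * ψ x * Complex.I * z x := by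
    intro x
    have hd1 : HasDerivAt (fun y => (starRingEnd ℂ) (z y)) ((starRingEnd ℂ) (deriv z x)) x :=
      Complex.conjCLE.hasFDerivAt.comp_hasDerivAt x (hzd x)
    have hd2 := hd1.mul (hzd x)
    have hd3 : HasDerivAt (fun y => (starRingEnd ℂ) (z y) * z y) 0 x := by
      simp only [hone]; exact hasDerivAt_const x 1
    have h0 := hd2.unique hd3
    have hre : ((starRingEnd ℂ) (z x) * deriv z x).re = 0 := by
      have := congrArg Complex.re h0
      simp at this ⊢
      linarith
    have him : ((starRingEnd ℂ) (z x) * deriv z x).im = 2 * ψ x := by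
      rw [hψ]; unfold angularVelocity; ring
    have hc : (starRingEnd ℂ) (z x) * deriv z x = 2 * ψ x * Complex.I := by
      apply Complex.ext
      · rw [hre]; simp
      · rw [him]; simp
    calc deriv z x = ((starRingEnd ℂ) (z x) * z x) * deriv z x := by rw [hone, one_mul]
      _ = ((starRingEnd ℂ) (z x) * deriv z x) * z x := by ring
      _ = _ := by rw [hc]
  set φ : ℝ → ℝ := fun x => Complex.arg (z 0) / 2 + ∫ y in (0 : ℝ)..x, ψ y with hφ
  have hφd : ∀ x, HasDerivAt φ (ψ x) x := fun x => by
    have := intervalIntegral.integral_hasDerivAt_right (hψc.intervalIntegrable 0 x)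
      hψc.aestronglyMeasurable.stronglyMeasurableAtFilter hψc.continuousAt
    exact this.const_add _
  have hφ0 : Complex.exp (2 * φ 0 * Complex.I) = z 0 := by
    have hn : ‖z 0‖ = 1 := by
      have := congrArg norm (hone 0)
      rw [norm_mul, RCLike.norm_conj, norm_one] at this
      nlinarith [norm_nonneg (z 0)]
    have := Complex.norm_mul_exp_arg_mul_I (z 0)
    rw [hn] at this
    rw [hφ]
    simp
    simpa [mul_div_cancel₀] using this
  have hconst : ∀ x, z x * Complex.exp (-(2 * φ x * Complex.I)) = 1 := by
    have hd : ∀ x, HasDerivAt (fun x => z x * Complex.exp (-(2 * φ x * Complex.I))) 0 x := by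
      intro x
      have e1 : HasDerivAt (fun x => -(2 * (φ x : ℂ) * Complex.I))
          (-(2 * (ψ x : ℂ) * Complex.I)) x :=
        (((hφd x).ofReal_comp.const_mul 2).mul_const Complex.I).neg
      have e2 := (hzd x).mul e1.cexp
      have e3 : deriv z x * Complex.exp (-(2 * ↑(φ x) * Complex.I)) +
          z x * (Complex.exp (-(2 * ↑(φ x) * Complex.I)) * -(2 * ↑(ψ x) * Complex.I)) = 0 := by
        rw [hode]
        ring
      rw [e3] at e2
      exact e2
    intro x
    have := is_const_of_deriv_eq_zero (fun x => (hd x).differentiableAt) (fun x => (hd x).deriv) x 0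
    rw [this, ← hφ0, ← Complex.exp_add]
    simp
  refine ⟨φ, hφd, fun x => eq_mk_of_toCircle_eq _ _ ?_⟩
  have := hconst x
  rw [Complex.exp_neg] at this
  field_simp at this
  exact this

/-- Every developing map has a normalized lift. -/
theorem DevelopingMap.exists_normalizedLift {κ : Deck} (γ : DevelopingMap κ) :
    ∃ u : (ℝ → ℝ) × (ℝ → ℝ), IsNormalizedLift γ u.1 u.2 := by
  obtain ⟨φ, hφd, hφ⟩ := exists_angle γ.smooth
  have hψ := contDiff_angularVelocity γ.smooth
  have hpos := γ.orientation
  set ψ := angularVelocity γ.toFun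
  have hφs : ContDiff ℝ ∞ φ := by
    rw [contDiff_infty_iff_deriv]
    refine ⟨fun x => (hφd x).differentiableAt, ?_⟩
    rwa [show deriv φ = ψ from funext fun x => (hφd x).deriv]
  set ρ : ℝ → ℝ := fun x => (ψ x) ^ (-(1 / 2) : ℝ) with hρ
  have hρs : ContDiff ℝ ∞ ρ := hψ.rpow_const_of_ne fun x => (hpos x).ne'
  have hρpos : ∀ x, 0 < ρ x := fun x => Real.rpow_pos_of_pos (hpos x) _
  have hρd : ∀ x, HasDerivAt ρ (deriv ρ x) x := fun x =>
    (hρs.differentiable (by simp) x).hasDerivAt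
  refine ⟨(fun x => ρ x * Real.sin (φ x), fun x => ρ x * Real.cos (φ x)),
    hρs.mul (Real.contDiff_sin.comp hφs), hρs.mul (Real.contDiff_cos.comp hφs), fun x => ?_,
    fun x => ?_⟩
  · have d1 := ((hρd x).mul (hφd x).sin).deriv
    have d2 := ((hρd x).mul (hφd x).cos).deriv
    have hsq : ρ x ^ 2 * ψ x = 1 := by
      rw [hρ]
      simp only
      rw [← Real.rpow_natCast, ← Real.rpow_mul (hpos x).le]
      norm_num
      rw [Real.rpow_neg_one]
      exact inv_mul_cancel₀ (hpos x).ne'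
    unfold wronskian
    simp only
    erw [d1, d2]
    have hcs := Real.sin_sq_add_cos_sq (φ x)
    linear_combination (-(ρ x ^ 2 * ψ x)) * hcs - hsq
  · have e : ![ρ x * Real.sin (φ x), ρ x * Real.cos (φ x)] =
        ρ x • ![Real.sin (φ x), Real.cos (φ x)] := by simp
    have hne : ![ρ x * Real.sin (φ x), ρ x * Real.cos (φ x)] ≠ 0 := by
      rw [e]; exact smul_ne_zero (hρpos x).ne' (sin_cos_ne_zero _)
    refine ⟨hne, ?_⟩
    rw [hφ x, eq_comm, Projectivization.mk_eq_mk_iff']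
    exact ⟨ρ x, e.symm⟩

theorem jet_pullback (κ : Deck) {u : ℝ → ℝ} (hu : ContDiff ℝ ∞ u) (x : ℝ) :
    jet (κ.pullback (-(1 / 2)) u) x =
      (κ.jetMap x : Matrix (Fin 2) (Fin 2) ℝ).mulVec (jet u (κ x)) := by
  have hk : HasDerivAt κ (deriv κ x) x := (κ.smooth.differentiable (by simp) x).hasDerivAt
  have hk' : HasDerivAt (deriv κ) (deriv (deriv κ) x) x :=
    ((contDiff_infty_iff_deriv.1 κ.smooth).2.differentiable (by simp) x).hasDerivAt
  have hu' : HasDerivAt u (deriv u (κ x)) (κ x) := (hu.differentiable (by simp) _).hasDerivAt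
  have hp := κ.deriv_pos x
  have h1 := hk'.rpow_const (p := (-(1 / 2) : ℝ)) (Or.inl hp.ne')
  have h2 := (h1.mul (hu'.comp x hk)).deriv
  have e1 : (deriv κ x) ^ (1 / 2 : ℝ) = (deriv κ x) ^ (-(1 / 2) : ℝ) * deriv κ x := by
    conv_rhs => rw [← Real.rpow_add_one hp.ne']
    norm_num
  ext i
  fin_cases i
  · have h3 : deriv (κ.pullback (-(1 / 2)) u) x = _ := h2
    simp only [jet, Deck.jetMap, Matrix.mulVec, dotProduct, Fin.sum_univ_two]
    rw [h3, e1]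
    norm_num
    ring
  · simp [jet, Deck.jetMap, Matrix.mulVec, dotProduct, Fin.sum_univ_two, Deck.pullback]

theorem psl2_eq_of_smul {A B : SL2} {ε : ℝ} (hε : ε ^ 2 = 1)
    (h : (A : Matrix (Fin 2) (Fin 2) ℝ) = ε • (B : Matrix (Fin 2) (Fin 2) ℝ)) :
    (A : PSL2) = (B : PSL2) := by
  rw [eq_comm]
  refine QuotientGroup.eq.2 ?_
  rw [Matrix.SpecialLinearGroup.mem_center_iff]
  refine ⟨ε, by simpa using hε, ?_⟩
  rw [Matrix.SpecialLinearGroup.coe_mul, h, Matrix.mul_smul, ← Matrix.SpecialLinearGroup.coe_mul]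
  simp [Matrix.smul_one_eq_diagonal]

/-- The `SL(2, ℝ)`-frame of the jet bundle at `x` given by a pair of densities with Wronskian
`-1`: the matrix with columns `j¹_x(u₁)` and `j¹_x(u₂)`. -/
def IsNormalizedLift.frame {γ : ℝ → RP1} {u₁ u₂ : ℝ → ℝ} (h : IsNormalizedLift γ u₁ u₂) (x : ℝ) :
    SL2 :=
  ⟨!![deriv u₁ x, deriv u₂ x; u₁ x, u₂ x], by
    have := h.wronskian_eq x
    unfold wronskian at this
    rw [Matrix.det_fin_two_of]
    linarith⟩

theorem IsNormalizedLift.frame_quasiPeriodic {κ : Deck} {γ : ℝ → RP1} {u₁ u₂ : ℝ → ℝ}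
    (h : IsNormalizedLift γ u₁ u₂) {A : SL2} (hA : ∀ x, γ (κ x) = A • γ x) (x : ℝ) :
    ((κ.jetMap x : SL2) : PSL2) * (h.frame (κ x) : PSL2) =
      (h.frame x : PSL2) * (A.transpose : PSL2) := by
  set a := A 0 0
  set b := A 0 1
  set c := A 1 0
  set d := A 1 1
  have hdet : a * d - b * c = 1 := by
    have := A.2
    rwa [Matrix.det_fin_two] at this
  -- the two normalized lifts of `γ ∘ κ`
  set w₁ := κ.pullback (-(1 / 2)) u₁ with hw₁
  set w₂ := κ.pullback (-(1 / 2)) u₂ with hw₂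
  set v₁ : ℝ → ℝ := fun y => a * u₁ y + b * u₂ y with hv₁
  set v₂ : ℝ → ℝ := fun y => c * u₁ y + d * u₂ y with hv₂
  have hu₁ : ∀ y, HasDerivAt u₁ (deriv u₁ y) y := fun y =>
    (h.smooth₁.differentiable (by simp) y).hasDerivAt
  have hu₂ : ∀ y, HasDerivAt u₂ (deriv u₂ y) y := fun y =>
    (h.smooth₂.differentiable (by simp) y).hasDerivAt
  have hk : ContDiff ℝ ∞ (deriv κ) := (contDiff_infty_iff_deriv.1 κ.smooth).2
  have hw₁s : ContDiff ℝ ∞ w₁ :=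
    (hk.rpow_const_of_ne fun y => (κ.deriv_pos y).ne').mul (h.smooth₁.comp κ.smooth)
  have hw₂s : ContDiff ℝ ∞ w₂ :=
    (hk.rpow_const_of_ne fun y => (κ.deriv_pos y).ne').mul (h.smooth₂.comp κ.smooth)
  have hdw₁ : ∀ y, HasDerivAt w₁ (deriv w₁ y) y := fun y =>
    (hw₁s.differentiable (by simp) y).hasDerivAt
  have hdw₂ : ∀ y, HasDerivAt w₂ (deriv w₂ y) y := fun y =>
    (hw₂s.differentiable (by simp) y).hasDerivAt
  have hdv₁ : ∀ y, HasDerivAt v₁ (a * deriv u₁ y + b * deriv u₂ y) y := fun y =>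
    ((hu₁ y).const_mul a).add ((hu₂ y).const_mul b)
  have hdv₂ : ∀ y, HasDerivAt v₂ (c * deriv u₁ y + d * deriv u₂ y) y := fun y =>
    ((hu₁ y).const_mul c).add ((hu₂ y).const_mul d)
  have hWu : ∀ y, u₁ y * deriv u₂ y - u₂ y * deriv u₁ y = -1 := h.wronskian_eq
  have hvne : ∀ y, v₁ y ^ 2 + v₂ y ^ 2 ≠ 0 := by
    intro y h0
    have e1 : v₁ y = 0 := by nlinarith [sq_nonneg (v₁ y), sq_nonneg (v₂ y)]
    have e2 : v₂ y = 0 := by nlinarith [sq_nonneg (v₁ y), sq_nonneg (v₂ y)]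
    have e3 : u₁ y = d * v₁ y - b * v₂ y := by
      simp only [hv₁, hv₂]; linear_combination (-(u₁ y)) * hdet
    have e4 : u₂ y = a * v₂ y - c * v₁ y := by
      simp only [hv₁, hv₂]; linear_combination (-(u₂ y)) * hdet
    have := hWu y
    rw [e3, e4, e1, e2] at this
    norm_num at this
  -- the Wronskian of the pulled back pair
  have hF : ∀ y, !![deriv w₁ y, deriv w₂ y; w₁ y, w₂ y] =
      ((κ.jetMap y * h.frame (κ y) : SL2) : Matrix (Fin 2) (Fin 2) ℝ) := by
    intro y
    have j1 := jet_pullback κ h.smooth₁ y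
    have j2 := jet_pullback κ h.smooth₂ y
    ext i j
    rw [Matrix.SpecialLinearGroup.coe_mul, Matrix.mul_apply, Fin.sum_univ_two]
    have j1i := congrFun j1 i
    have j2i := congrFun j2 i
    simp only [Matrix.mulVec, dotProduct, Fin.sum_univ_two] at j1i j2i
    fin_cases i <;> fin_cases j <;> simpa [jet, IsNormalizedLift.frame] using ‹_›
  have hWw : ∀ y, deriv w₁ y * w₂ y - deriv w₂ y * w₁ y = 1 := by
    intro y
    have := (κ.jetMap y * h.frame (κ y) : SL2).2
    rwa [← hF y, Matrix.det_fin_two_of] at this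
  -- the ratio of the two lifts
  have hpar : ∀ y, w₁ y * v₂ y = w₂ y * v₁ y := by
    intro y
    obtain ⟨h1, e1⟩ := h.eq_mk (κ y)
    obtain ⟨h2, e2⟩ := h.eq_mk y
    have e3 := hA y
    rw [e1, e2, Projectivization.smul_mk, Projectivization.mk_eq_mk_iff'] at e3
    obtain ⟨l, hl⟩ := e3
    have l0 := congrFun hl 0
    have l1 := congrFun hl 1
    have s0 : (A • ![u₁ y, u₂ y]) 0 = v₁ y := by
      change (Matrix.mulVec (A : Matrix (Fin 2) (Fin 2) ℝ) ![u₁ y, u₂ y]) 0 = _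
      simp [Matrix.mulVec, dotProduct, Fin.sum_univ_two, hv₁, a, b]
    have s1 : (A • ![u₁ y, u₂ y]) 1 = v₂ y := by
      change (Matrix.mulVec (A : Matrix (Fin 2) (Fin 2) ℝ) ![u₁ y, u₂ y]) 1 = _
      simp [Matrix.mulVec, dotProduct, Fin.sum_univ_two, hv₂, c, d]
    rw [Pi.smul_apply, s0] at l0
    rw [Pi.smul_apply, s1] at l1
    simp at l0 l1
    simp only [hw₁, hw₂, Deck.pullback]
    rw [← l0, ← l1]
    ring
  set lam : ℝ → ℝ := fun y => (w₁ y * v₁ y + w₂ y * v₂ y) / (v₁ y ^ 2 + v₂ y ^ 2) with hlam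
  have hlw₁ : ∀ y, w₁ y = lam y * v₁ y := by
    intro y
    have := hvne y
    simp only [hlam]
    field_simp
    linear_combination (v₂ y) * hpar y
  have hlw₂ : ∀ y, w₂ y = lam y * v₂ y := by
    intro y
    have := hvne y
    simp only [hlam]
    field_simp
    linear_combination (-(v₁ y)) * hpar y
  have hlamd : ∀ y, DifferentiableAt ℝ lam y := fun y =>
    (((hdw₁ y).mul (hdv₁ y)).add ((hdw₂ y).mul (hdv₂ y))).differentiableAt.div
      (((hdv₁ y).pow 2).add ((hdv₂ y).pow 2)).differentiableAt (hvne y)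
  have hD₁ : ∀ y, deriv w₁ y = deriv lam y * v₁ y + lam y * (a * deriv u₁ y + b * deriv u₂ y) := by
    intro y
    have := ((hlamd y).hasDerivAt.mul (hdv₁ y)).deriv
    rw [← this]
    congr 1
    exact funext hlw₁
  have hD₂ : ∀ y, deriv w₂ y = deriv lam y * v₂ y + lam y * (c * deriv u₁ y + d * deriv u₂ y) := by
    intro y
    have := ((hlamd y).hasDerivAt.mul (hdv₂ y)).deriv
    rw [← this]
    congr 1
    exact funext hlw₂
  have hsq : ∀ y, lam y ^ 2 = 1 := by
    intro y
    have e := hWw y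
    rw [hD₁, hD₂, hlw₁, hlw₂] at e
    simp only [hv₁, hv₂] at e
    have e2 : lam y ^ 2 * ((a * d - b * c) * (u₁ y * deriv u₂ y - u₂ y * deriv u₁ y)) = -1 := by
      linear_combination -e
    rw [hdet, hWu] at e2
    linarith
  have hlam0 : deriv lam x = 0 := by
    have e1 := ((hlamd x).hasDerivAt.pow 2)
    have e2 : HasDerivAt (lam ^ 2) 0 x := by
      rw [show lam ^ 2 = fun _ => (1 : ℝ) from funext hsq]
      exact hasDerivAt_const x 1
    have e3 := e1.unique e2
    have hne : lam x ≠ 0 := fun h0 => by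
      have := hsq x
      rw [h0] at this
      norm_num at this
    simpa [hne] using e3
  rw [← QuotientGroup.mk_mul, ← QuotientGroup.mk_mul]
  refine psl2_eq_of_smul (hsq x) ?_
  rw [← hF x, hD₁, hD₂, hlw₁, hlw₂, hlam0]
  ext i j
  rw [Matrix.SpecialLinearGroup.coe_mul, Matrix.smul_apply, Matrix.mul_apply, Fin.sum_univ_two]
  fin_cases i <;> fin_cases j <;>
    simp [IsNormalizedLift.frame, hv₁, hv₂, a, b, c, d, Matrix.SpecialLinearGroup.transpose] <;> ring_nf <;> simp

theorem maurerCartan_eq {c : ℝ → PSL2} {g : ℝ → SL2} (hg : IsLiftAtZero c g) :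
    maurerCartan c = logDerivAtZero g := by
  have hex : ∃ g, IsLiftAtZero c g := ⟨g, hg⟩
  unfold maurerCartan
  rw [dif_pos hex]
  set f := hex.choose
  have hf : IsLiftAtZero c f := hex.choose_spec
  -- the two lifts differ by a sign
  have hsgn : ∀ᶠ t in 𝓝 (0 : ℝ), ∃ r : ℝ, r ^ 2 = 1 ∧ ∀ i j, f t i j = r * g t i j := by
    filter_upwards [hf.2, hg.2] with t h1 h2
    have h3 : (g t : PSL2) = (f t : PSL2) := h2.symm.trans h1
    have h4 := QuotientGroup.eq.1 h3
    rw [Matrix.SpecialLinearGroup.mem_center_iff] at h4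
    obtain ⟨r, hr, hr'⟩ := h4
    refine ⟨r, by simpa using hr, fun i j => ?_⟩
    have h5 : (f t : Matrix (Fin 2) (Fin 2) ℝ) = (g t : Matrix (Fin 2) (Fin 2) ℝ) * Matrix.scalar (Fin 2) r := by
      rw [hr', ← Matrix.SpecialLinearGroup.coe_mul]
      simp
    have h6 := congrFun (congrFun h5 i) j
    rw [h6]
    simp [mul_comm]
  obtain ⟨ε, hε, hε0⟩ := hsgn.self_of_nhds
  obtain ⟨i₀, j₀, hne⟩ : ∃ i j, g 0 i j ≠ 0 := by
    by_contra hall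
    push Not at hall
    have := (g 0).2
    rw [Matrix.det_fin_two] at this
    simp [hall] at this
  have hcont : ContinuousAt (fun t => ε * f t i₀ j₀ * g t i₀ j₀) 0 :=
    (continuousAt_const.mul (hf.1 i₀ j₀).continuousAt).mul (hg.1 i₀ j₀).continuousAt
  have hpos : 0 < ε * f 0 i₀ j₀ * g 0 i₀ j₀ := by
    rw [hε0]
    have : ε * (ε * g 0 i₀ j₀) * g 0 i₀ j₀ = ε ^ 2 * (g 0 i₀ j₀) ^ 2 := by ring
    rw [this, hε, one_mul]
    positivity
  have hev : ∀ᶠ t in 𝓝 (0 : ℝ), ∀ i j, f t i j = ε * g t i j := by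
    filter_upwards [hsgn, hcont.eventually (lt_mem_nhds hpos)] with t ⟨r, hr, hrt⟩ hp i j
    rw [hrt i₀ j₀] at hp
    have h1 : 0 < (ε * r) * (g t i₀ j₀) ^ 2 := by
      calc 0 < ε * (r * g t i₀ j₀) * g t i₀ j₀ := hp
        _ = _ := by ring
    have h2 : 0 < ε * r := pos_of_mul_pos_left h1 (sq_nonneg _)
    have pm : ∀ {q : ℝ}, q ^ 2 = 1 → q = 1 ∨ q = -1 := fun hq =>
      sq_eq_sq_iff_eq_or_eq_neg.1 (by rw [hq, one_pow])
    have h3 : r = ε := by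
      rcases (pm hr) with h5 | h5 <;>
      rcases (pm hε) with h6 | h6 <;> rw [h5, h6] at h2 ⊢ <;> norm_num at h2
    rw [hrt i j, h3]
  have hder : ∀ i j, deriv (fun t => f t i j) 0 = ε * deriv (fun t => g t i j) 0 := by
    intro i j
    have : (fun t => f t i j) =ᶠ[𝓝 0] fun t => ε * g t i j := hev.mono fun t ht => ht i j
    rw [this.deriv_eq, deriv_const_mul _ (hg.1 i j)]
  unfold logDerivAtZero
  ext i j
  rw [Matrix.SpecialLinearGroup.coe_inv, Matrix.SpecialLinearGroup.coe_inv,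
    Matrix.adjugate_fin_two, Matrix.adjugate_fin_two, Matrix.mul_apply, Matrix.mul_apply,
    Fin.sum_univ_two, Fin.sum_univ_two]
  simp only [Matrix.of_apply, hder, hε0]
  have hcancel : ∀ p q r s : ℝ, ε * p * (ε * q) + ε * r * (ε * s) = p * q + r * s := by
    intro p q r s
    linear_combination (p * q + r * s) * hε
  fin_cases i
  · have := hcancel (g 0 1 1) (deriv (fun t => g t 0 j) 0) (-(g 0 0 1)) (deriv (fun t => g t 1 j) 0)
    simpa using this
  · have := hcancel (-(g 0 1 0)) (deriv (fun t => g t 0 j) 0) (g 0 0 0) (deriv (fun t => g t 1 j) 0)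
    simpa using this

theorem lieDeriv_hill_sub {T v f : ℝ → ℝ} (hT : ContDiff ℝ ∞ T) (hv : ContDiff ℝ ∞ v)
    (hf : ContDiff ℝ ∞ f) (x : ℝ) :
    lieDeriv (3 / 2) v (hill T f) x - hill T (lieDeriv (-(1 / 2)) v f) x =
      -(hillD T v x) * f x := by
  have dd : ∀ {g : ℝ → ℝ}, ContDiff ℝ ∞ g → ContDiff ℝ ∞ (deriv g) := fun hg =>
    (contDiff_infty_iff_deriv.1 hg).2
  have da : ∀ {g : ℝ → ℝ}, ContDiff ℝ ∞ g → ∀ y, HasDerivAt g (deriv g y) y := fun hg y =>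
    (hg.differentiable (by simp) y).hasDerivAt
  have i2 : ∀ g : ℝ → ℝ, iteratedDeriv 2 g = deriv (deriv g) := fun g => by
    rw [iteratedDeriv_succ, iteratedDeriv_one]
  have i3 : ∀ g : ℝ → ℝ, iteratedDeriv 3 g = deriv (deriv (deriv g)) := fun g => by
    rw [iteratedDeriv_succ, i2]
  have e1 : deriv (hill T f) x =
      deriv (deriv (deriv f)) x + (deriv T x * f x + T x * deriv f x) := by
    have := ((da (dd (dd hf)) x).add ((da hT x).mul (da hf x))).deriv
    rw [← this]
    congr 1
    funext y
    simp [hill, i2]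
  have e2 : deriv (lieDeriv (-(1 / 2)) v f) = fun y => deriv v y * deriv f y + v y * deriv (deriv f) y +
      (-(1 / 2)) * (deriv (deriv v) y * f y + deriv v y * deriv f y) := by
    funext y
    have := (((da hv y).mul (da (dd hf) y)).add
      (((da (dd hv) y).mul (da hf y)).const_mul (-(1 / 2)))).deriv
    rw [← this]
    congr 1
    funext y
    simp [lieDeriv]
    ring
  have e3 : deriv (deriv (lieDeriv (-(1 / 2)) v f)) x =
      deriv (deriv v) x * deriv f x + deriv v x * deriv (deriv f) x +
        (deriv v x * deriv (deriv f) x + v x * deriv (deriv (deriv f)) x) +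
      (-(1 / 2)) * (deriv (deriv (deriv v)) x * f x + deriv (deriv v) x * deriv f x +
        (deriv (deriv v) x * deriv f x + deriv v x * deriv (deriv f) x)) := by
    rw [e2]
    exact ((((da (dd hv) x).mul (da (dd hf) x)).add ((da hv x).mul (da (dd (dd hf)) x))).add
      ((((da (dd (dd hv)) x).mul (da hf x)).add ((da (dd hv) x).mul (da (dd hf) x))).const_mul
        (-(1 / 2)))).deriv
  have e4 : hill T (lieDeriv (-(1 / 2)) v f) x =
      deriv (deriv (lieDeriv (-(1 / 2)) v f)) x + T x * lieDeriv (-(1 / 2)) v f x := by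
    simp [hill, i2]
  rw [e4, e3]
  unfold hillD
  rw [i3]
  simp only [lieDeriv]
  rw [e1]
  simp only [hill, i2]
  ring

theorem hasDerivAt_concomitant {T v w : ℝ → ℝ} (hT : ContDiff ℝ ∞ T) (hv : ContDiff ℝ ∞ v)
    (hw : ContDiff ℝ ∞ w) (x : ℝ) :
    HasDerivAt (fun y => concomitant T y v w) (-(hillD T v x * w x + v x * hillD T w x)) x := by
  have dd : ∀ {g : ℝ → ℝ}, ContDiff ℝ ∞ g → ContDiff ℝ ∞ (deriv g) := fun hg =>
    (contDiff_infty_iff_deriv.1 hg).2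
  have da : ∀ {g : ℝ → ℝ}, ContDiff ℝ ∞ g → ∀ y, HasDerivAt g (deriv g y) y := fun hg y =>
    (hg.differentiable (by simp) y).hasDerivAt
  have i2 : ∀ g : ℝ → ℝ, iteratedDeriv 2 g = deriv (deriv g) := fun g => by
    rw [iteratedDeriv_succ, iteratedDeriv_one]
  have i3 : ∀ g : ℝ → ℝ, iteratedDeriv 3 g = deriv (deriv (deriv g)) := fun g => by
    rw [iteratedDeriv_succ, i2]
  have h1 := ((((da hT x).const_mul 2).mul (da hv x)).mul (da hw x)).add
    (((((da (dd (dd hv)) x).mul (da hw x)).sub ((da (dd hv) x).mul (da (dd hw) x))).add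
      ((da hv x).mul (da (dd (dd hw)) x))).const_mul (1 / 2))
  unfold concomitant hillD
  simp only [i2, i3]
  refine h1.congr_deriv ?_
  simp only [Pi.mul_apply]
  ring

/-! ### The forms on the space of developing maps

A smooth curve in `𝒟(C)` is a curve of developing maps that is jointly smooth in the parameter `t`
and the point `x`. Tangent vectors are the velocities at `t = 0` of smooth curves, and differential
forms are evaluated on curves that represent the tangent vectors. -/

namespace DevelopingMap

variable {κ : Deck}

/-- Smooth curves in the space of developing maps. -/
def IsSmoothCurve (c : ℝ → DevelopingMap κ) : Prop :=
  SmoothToRP1 (fun p : ℝ × ℝ => c p.1 p.2)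

/-- The normalized lift `(u₁, u₂)` (one of the two, which differ by an overall sign). -/
def lift (γ : DevelopingMap κ) : (ℝ → ℝ) × (ℝ → ℝ) := γ.exists_normalizedLift.choose

theorem lift_spec (γ : DevelopingMap κ) : IsNormalizedLift γ γ.lift.1 γ.lift.2 :=
  γ.exists_normalizedLift.choose_spec

/-- The potential `T` of the Hill operator `p(γ)` with the fundamental system of solutions `u₁, u₂`:
the coefficient of `u` in
`L u = det (u'', u₁'', u₂''; u', u₁', u₂'; u, u₁, u₂) = u'' + T u`. -/
def potential (γ : DevelopingMap κ) (x : ℝ) : ℝ :=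
  iteratedDeriv 2 γ.lift.1 x * deriv γ.lift.2 x - iteratedDeriv 2 γ.lift.2 x * deriv γ.lift.1 x

/-- The `1`-form `Θ = - dφ / φ'` with values in vector fields on the line, on the velocity at
`t = 0` of the curve `c`: minus the vector field on the line that `γ = c 0` maps to the velocity,
a vector field along `γ`. -/
def theta (c : ℝ → DevelopingMap κ) (x : ℝ) : ℝ :=
  -(angularVelocity (fun t => c t x) 0 / angularVelocity (c 0) x)

/-- The `2`-form `ϖ_𝒟 = ∫_{x₀}^{κ x₀} (D_L Θ) ∧ Θ + B_{L, x₀}(Θ ∧ κ^* Θ)` at `γ = c₁ 0 = c₂ 0`,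
with `L = p(γ)`, on the velocities at `t = 0` of `c₁` and `c₂`. -/
def varpi (x₀ : ℝ) (c₁ c₂ : ℝ → DevelopingMap κ) : ℝ :=
  (∫ x in x₀..κ x₀,
      (hillD (c₁ 0).potential (theta c₁) x * theta c₂ x -
        hillD (c₁ 0).potential (theta c₂) x * theta c₁ x)) +
    (concomitant (c₁ 0).potential x₀ (theta c₁) (κ.pullback (-1) (theta c₂)) -
      concomitant (c₁ 0).potential x₀ (theta c₂) (κ.pullback (-1) (theta c₁)))

end DevelopingMap

/-! ### Quasi-periodic sections

The jet bundle `E = J¹(|Λ|^{-1/2})` over `C` pulls back to the bundle `ℝ × ℝ²` over `ℝ`, in the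
trivialization `jet`, with the identification `Deck.jetMap` of the fibres at `κ x` and `x`. The
`SL(2, ℝ)`-frames at `x` are the pairs of jets of densities `u₁, u₂` with Wronskian `-1`, that is,
the matrices in `SL(2, ℝ)` with these jets as columns. Therefore the pull-back of the principal
bundle `Q` is `ℝ × PSL(2, ℝ)`, where the structure group acts by right multiplication. -/

/-- The space `𝒫(Q)` of sections `τ` of the pull-back of `Q` with `κ^* τ = h · τ` for some `h` in
`PSL(2, ℝ)`, where `h` acts as the right multiplication by `h⁻¹`. -/
structure QuasiPeriodicSection (κ : Deck) where
  /-- the underlying section -/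
  toFun : ℝ → PSL2
  smooth : SmoothToPSL2 toFun
  quasiPeriodic : ∃ h : PSL2, ∀ x, ((κ.jetMap x : SL2) : PSL2) * toFun (κ x) = toFun x * h⁻¹

instance (κ : Deck) : CoeFun (QuasiPeriodicSection κ) (fun _ => ℝ → PSL2) :=
  ⟨QuasiPeriodicSection.toFun⟩

namespace QuasiPeriodicSection

variable {κ : Deck}

/-- Smooth curves in the space of quasi-periodic sections. -/
def IsSmoothCurve (c : ℝ → QuasiPeriodicSection κ) : Prop :=
  SmoothToPSL2 (fun p : ℝ × ℝ => c p.1 p.2)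

/-- The monodromy `q(τ) = h`, which is unique. -/
def monodromy (τ : QuasiPeriodicSection κ) : PSL2 := τ.quasiPeriodic.choose

/-- The `1`-form `Ξ_x`, the pull-back under the evaluation `τ ↦ τ(x)` of the connection form
`θ^L` of the fibre at `x`, on the velocity at `t = 0` of the curve `c`. -/
def xi (c : ℝ → QuasiPeriodicSection κ) (x : ℝ) : Matrix (Fin 2) (Fin 2) ℝ :=
  maurerCartan (fun t => c t x)

/-- The derivative `Ξ'` of `x ↦ Ξ_x`. -/
def xiDeriv (c : ℝ → QuasiPeriodicSection κ) (x : ℝ) : Matrix (Fin 2) (Fin 2) ℝ :=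
  Matrix.of fun i j => deriv (fun y => xi c y i j) x

/-- The form `q^* θ^L` on the velocity at `t = 0` of the curve `c`. -/
def monodromyForm (c : ℝ → QuasiPeriodicSection κ) : Matrix (Fin 2) (Fin 2) ℝ :=
  maurerCartan (fun t => (c t).monodromy)

/-- The `2`-form `ϖ_𝒫 = - 1/2 ∫_{x₀}^{κ x₀} ⟨Ξ ∧ Ξ'⟩ + 1/2 ⟨Ξ_{x₀} ∧ q^* θ^L⟩` at
`τ = c₁ 0 = c₂ 0` on the velocities at `t = 0` of `c₁` and `c₂`. -/
def varpi (x₀ : ℝ) (c₁ c₂ : ℝ → QuasiPeriodicSection κ) : ℝ :=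
  -(1 / 2) * (∫ x in x₀..κ x₀,
      (metric (xi c₁ x) (xiDeriv c₂ x) - metric (xi c₂ x) (xiDeriv c₁ x))) +
    (1 / 2) * (metric (xi c₁ x₀) (monodromyForm c₂) - metric (xi c₂ x₀) (monodromyForm c₁))

end QuasiPeriodicSection

/-- The Drinfeld-Sokolov embedding `𝒟(C) → 𝒫(Q)`: it sends `γ` to the section whose value at `x` is
the frame `(j¹_x(u₁), j¹_x(u₂))`, up to sign, of the normalized lift `(u₁, u₂)`. -/
def iotaHat {κ : Deck} (γ : DevelopingMap κ) : QuasiPeriodicSection κ where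
  toFun x := (γ.lift_spec.frame x : PSL2)
  smooth p := by
    refine ⟨γ.lift_spec.frame, fun i j => ?_, Filter.Eventually.of_forall fun _ => rfl⟩
    have h1 := γ.lift_spec.smooth₁
    have h2 := γ.lift_spec.smooth₂
    fin_cases i <;> fin_cases j
    · exact (contDiff_infty_iff_deriv.1 h1).2.contDiffAt
    · exact (contDiff_infty_iff_deriv.1 h2).2.contDiffAt
    · exact h1.contDiffAt
    · exact h2.contDiffAt
  quasiPeriodic := by
    obtain ⟨h, hh⟩ := γ.quasiPeriodic
    obtain ⟨A, rfl⟩ := QuotientGroup.mk_surjective h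
    refine ⟨(A.transpose : PSL2)⁻¹, fun x => ?_⟩
    rw [inv_inv]
    exact γ.lift_spec.frame_quasiPeriodic hh x

end DrinfeldSokolov

end

noncomputable section

namespace DrinfeldSokolov

/-! ### Partial derivatives of functions of two variables -/

/-! Everything is computed in the frame `g(x)` whose columns are the 1-jets of the normalized lift
`u₁, u₂` of `γ`. The Hill equation makes it a solution of `g' = a g`, where `a = !![0, -T; 1, 0]`.
Along a curve of developing maps with `v = Θ`, the angle satisfies `∂φ/∂t = -v φ'` at `t = 0`, so
the lift varies by `∂u/∂t = -ℒ_v u`. On 1-jets of solutions this is a matrix `A_v` (`lieMatrix`),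
since `u''` can be replaced by `-T u`. Hence `∂g/∂t = A_v g` and `Ξ = g⁻¹ A_v g` (`xi_iotaHat`).

Three facts turn `ϖ_𝒫` into `ϖ_𝒟` at a common base point. The identity `A_v' = N + [a, A_v]`, with
`-D_L v` in the upper right corner of `N` as its only entry, gives `Ξ' = g⁻¹ N g`; the metric then
pairs `A_w` with `N` to `2 w D_L v`, which yields the integrand. The monodromy `g(κ x)⁻¹ J⁻¹ g(x)`,
with `J` the jet map of `κ`, has the logarithmic derivative `g⁻¹ (A_v - A_{κ^* v}) g`
(`monodromyForm_iotaHat`). Finally `⟨A_v, A_w⟩ = -2 B_L(v, w)`, and the terms without `κ^*` drop out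
of the wedge product by symmetry, which leaves the boundary term.

The base points are decoupled on the side of `𝒫(Q)`: differentiating the quasi-periodicity in `t`
gives `Ξ_{κ x} = Ad_h (Ξ_x - q^* θ^L)`, and by invariance of the metric the `x`-derivative of `ϖ_𝒫`
at the base point `x` vanishes (`baseChange_eq`).

The rest controls the sign of the lift. A simply connected parameter space provides a smooth angle,
hence a smooth lift, and a differentiable function with square `1` is constant. -/

theorem hasDerivAt_comp_prodMk_right {f : ℝ × ℝ → ℝ} (hf : ContDiff ℝ ∞ f) (t x : ℝ) :
    HasDerivAt (fun y => f (t, y)) (fderiv ℝ f (t, x) (0, 1)) x := by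
  have h1 : HasDerivAt (fun y : ℝ => (t, y)) ((0 : ℝ), (1 : ℝ)) x :=
    (hasDerivAt_const x t).prodMk (hasDerivAt_id x)
  exact ((hf.differentiable (by simp)) (t, x)).hasFDerivAt.comp_hasDerivAt x h1

theorem hasDerivAt_comp_prodMk_left {f : ℝ × ℝ → ℝ} (hf : ContDiff ℝ ∞ f) (t x : ℝ) :
    HasDerivAt (fun s => f (s, x)) (fderiv ℝ f (t, x) (1, 0)) t := by
  have h1 : HasDerivAt (fun s : ℝ => (s, x)) ((1 : ℝ), (0 : ℝ)) t :=
    (hasDerivAt_id t).prodMk (hasDerivAt_const t x)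
  exact ((hf.differentiable (by simp)) (t, x)).hasFDerivAt.comp_hasDerivAt t h1

theorem contDiff_fderiv_apply {f : ℝ × ℝ → ℝ} (hf : ContDiff ℝ ∞ f) (v : ℝ × ℝ) :
    ContDiff ℝ ∞ (fun p => fderiv ℝ f p v) :=
  (hf.fderiv_right (m := ∞) (by simp)).clm_apply contDiff_const

theorem contDiff_deriv_right {f : ℝ × ℝ → ℝ} (hf : ContDiff ℝ ∞ f) :
    ContDiff ℝ ∞ (fun p : ℝ × ℝ => deriv (fun y => f (p.1, y)) p.2) := by
  simp_rw [fun p : ℝ × ℝ => (hasDerivAt_comp_prodMk_right hf p.1 p.2).deriv]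
  exact contDiff_fderiv_apply hf _

theorem contDiff_deriv_left {f : ℝ × ℝ → ℝ} (hf : ContDiff ℝ ∞ f) :
    ContDiff ℝ ∞ (fun p : ℝ × ℝ => deriv (fun s => f (s, p.2)) p.1) := by
  simp_rw [fun p : ℝ × ℝ => (hasDerivAt_comp_prodMk_left hf p.1 p.2).deriv]
  exact contDiff_fderiv_apply hf _

/-- The mixed second partial derivatives agree. -/
theorem hasDerivAt_deriv_right {f : ℝ × ℝ → ℝ} (hf : ContDiff ℝ ∞ f) (t x : ℝ) :
    HasDerivAt (fun s => deriv (fun y => f (s, y)) x)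
      (deriv (fun y => deriv (fun s => f (s, y)) t) x) t := by
  have e1 : (fun s => deriv (fun y => f (s, y)) x) = fun s => fderiv ℝ f (s, x) (0, 1) :=
    funext fun s => (hasDerivAt_comp_prodMk_right hf s x).deriv
  have e2 : (fun y => deriv (fun s => f (s, y)) t) = fun y => fderiv ℝ f (t, y) (1, 0) :=
    funext fun y => (hasDerivAt_comp_prodMk_left hf t y).deriv
  have hd : DifferentiableAt ℝ (fderiv ℝ f) (t, x) :=
    (hf.fderiv_right (m := ∞) (by simp)).differentiable (by simp) _
  have hsymm : IsSymmSndFDerivAt ℝ f (t, x) := by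
    refine hf.contDiffAt.isSymmSndFDerivAt ?_
    simp only [minSmoothness_of_isRCLikeNormedField]
    exact WithTop.coe_le_coe.2 (le_top : (2 : ℕ∞) ≤ ⊤)
  have hv : ∀ v w : ℝ × ℝ, fderiv ℝ (fun p => fderiv ℝ f p v) (t, x) w =
      fderiv ℝ (fderiv ℝ f) (t, x) w v := by
    intro v w
    rw [fderiv_clm_apply hd (differentiableAt_const v)]
    simp
  rw [e1, e2, (hasDerivAt_comp_prodMk_right (contDiff_fderiv_apply hf (1, 0)) t x).deriv, hv,
    hsymm, ← hv]
  exact hasDerivAt_comp_prodMk_left (contDiff_fderiv_apply hf (0, 1)) t x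

theorem contDiff_comp_prodMk_right {f : ℝ × ℝ → ℝ} (hf : ContDiff ℝ ∞ f) (t : ℝ) :
    ContDiff ℝ ∞ (fun y => f (t, y)) :=
  hf.comp (contDiff_const.prodMk contDiff_id)

/-! ### Angles -/

/-- A continuous logarithm of a smooth function is smooth. -/
theorem contDiff_of_exp_eq {N : Type*} [NormedAddCommGroup N] [NormedSpace ℝ N] {F z : N → ℂ}
    (hF : Continuous F) (hz : ContDiff ℝ ∞ z) (h : ∀ p, Complex.exp (F p) = z p) :
    ContDiff ℝ ∞ F := by
  rw [contDiff_iff_contDiffAt]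
  intro p
  -- Near `p` the imaginary part of `F q - F p` stays in `(-π, π)` by continuity, so the principal
  -- branch of the logarithm recovers this difference from `z q / z p`, which is close to `1`.
  have h1 : ∀ᶠ q in 𝓝 p, F q = F p + Complex.log (z q / z p) := by
    have hc : ContinuousAt (fun q => (F q - F p).im) p :=
      (Complex.continuous_im.comp (hF.sub continuous_const)).continuousAt
    have hm : Set.Ioo (-Real.pi) Real.pi ∈ 𝓝 ((F p - F p).im) := by
      rw [sub_self, Complex.zero_im]
      exact Ioo_mem_nhds (by linarith [Real.pi_pos]) Real.pi_pos
    filter_upwards [hc hm] with q hq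
    rw [← h, ← h, ← Complex.exp_sub, Complex.log_exp hq.1 hq.2.le]
    ring
  refine ContDiffAt.congr_of_eventuallyEq ?_ h1
  have hzp : z p ≠ 0 := by rw [← h]; exact Complex.exp_ne_zero _
  have h2 : ContDiffAt ℝ ∞ (fun q => z q / z p) p := hz.contDiffAt.div_const _
  have h3 : ContDiffAt ℝ ∞ Complex.log (z p / z p) := by
    rw [div_self hzp]
    exact (Complex.contDiffAt_log Complex.one_mem_slitPlane).restrict_scalars ℝ
  exact contDiffAt_const.add (ContDiffAt.comp (f := fun q => z q / z p) p h3 h2)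

/-- A smooth map from the plane to the projective line has a smooth angle. -/
theorem exists_smooth_angle {f : ℝ × ℝ → RP1} (hf : SmoothToRP1 f) :
    ∃ φ : ℝ × ℝ → ℝ, ContDiff ℝ ∞ φ ∧
      ∀ p, f p = Projectivization.mk ℝ ![Real.sin (φ p), Real.cos (φ p)] (sin_cos_ne_zero _) := by
  have hne : ∀ p, toCircle (f p) ≠ 0 := fun p h0 => by
    have := conj_mul_toCircle (f p)
    simp [h0] at this
  -- The plane is simply connected and `toCircle ∘ f` avoids `0`, so it lifts through the covering
  -- `exp`. The lift is purely imaginary because the values have norm one; half its imaginary part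
  -- is the angle, since `(sin φ : cos φ)` corresponds to `exp (2 i φ)`.
  obtain ⟨F, ⟨-, hF⟩, -⟩ := Complex.isCoveringMapOn_exp.existsUnique_continuousMap_lifts
    (⟨fun p => toCircle (f p), ContDiff.continuous hf⟩ : C(ℝ × ℝ, ℂ))
    (a₀ := 0) (e₀ := Complex.log (toCircle (f 0))) (Complex.exp_log (hne 0)) hne
  have hexp : ∀ p, Complex.exp (F p) = toCircle (f p) := fun p => congrFun hF p
  have hFs : ContDiff ℝ ∞ F := contDiff_of_exp_eq F.continuous hf hexp
  refine ⟨fun p => (F p).im / 2, (Complex.imCLM.contDiff.comp hFs).div_const 2, fun p =>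
    eq_mk_of_toCircle_eq _ _ ?_⟩
  have hn : ‖toCircle (f p)‖ = 1 := by
    have := congrArg norm (conj_mul_toCircle (f p))
    rw [norm_mul, RCLike.norm_conj, norm_one] at this
    nlinarith [norm_nonneg (toCircle (f p))]
  have hre : (F p).re = 0 := by
    rw [← hexp, Complex.norm_exp] at hn
    exact Real.exp_eq_one_iff _ |>.1 hn
  rw [← hexp]
  congr 1
  apply Complex.ext <;> simp [hre, mul_div_cancel₀]

theorem angularVelocity_sin_cos {σ : ℝ → RP1} {φ : ℝ → ℝ} {φ' s : ℝ}
    (hσ : ∀ r, σ r = Projectivization.mk ℝ ![Real.sin (φ r), Real.cos (φ r)] (sin_cos_ne_zero _))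
    (hφ : HasDerivAt φ φ' s) : angularVelocity σ s = φ' := by
  have e : (fun r => toCircle (σ r)) = fun r => Complex.exp (2 * φ r * Complex.I) :=
    funext fun r => by rw [hσ, toCircle_sin_cos]
  have h1 : HasDerivAt (fun r => 2 * (φ r : ℂ) * Complex.I) (2 * (φ' : ℂ) * Complex.I) s :=
    (hφ.ofReal_comp.const_mul 2).mul_const Complex.I
  have hd : deriv (fun r => toCircle (σ r)) s = toCircle (σ s) * (2 * φ' * Complex.I) := by
    rw [e, h1.cexp.deriv, hσ, toCircle_sin_cos]
  unfold angularVelocity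
  rw [hd, ← mul_assoc, conj_mul_toCircle]
  simp

/-! ### Uniqueness of normalized lifts -/

theorem eq_of_sq_eq_one {l : ℝ → ℝ} (hl : Differentiable ℝ l) (h : ∀ x, l x ^ 2 = 1) (x y : ℝ) :
    l x = l y := by
  refine is_const_of_deriv_eq_zero hl (fun x => ?_) x y
  have e1 := (hl x).hasDerivAt.pow 2
  have e2 : HasDerivAt (l ^ 2) 0 x := by
    rw [show l ^ 2 = fun _ => (1 : ℝ) from funext h]
    exact hasDerivAt_const x 1
  have hne : l x ≠ 0 := fun h0 => by
    have := h x
    rw [h0] at this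
    norm_num at this
  simpa [hne] using e1.unique e2

/-- Two lifts of the same `γ` are proportional by a function `l`, and the Wronskian scales by `l ^
2`; hence `l ^ 2 = 1`, and `l` is constant. -/
theorem IsNormalizedLift.eq_or_neg {γ : ℝ → RP1} {u₁ u₂ w₁ w₂ : ℝ → ℝ}
    (hu : IsNormalizedLift γ u₁ u₂) (hw : IsNormalizedLift γ w₁ w₂) :
    ∃ ε : ℝ, ε ^ 2 = 1 ∧ (∀ x, w₁ x = ε * u₁ x) ∧ ∀ x, w₂ x = ε * u₂ x := by
  have dd : ∀ {g : ℝ → ℝ}, ContDiff ℝ ∞ g → Differentiable ℝ g := fun hg =>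
    hg.differentiable (by simp)
  have dd' : ∀ {g : ℝ → ℝ}, ContDiff ℝ ∞ g → Differentiable ℝ (deriv g) := fun hg =>
    (contDiff_infty_iff_deriv.1 hg).2.differentiable (by simp)
  -- If `w = l u`, this expression is `-l` times the Wronskian of `u`, that is, `l`. It defines the
  -- ratio without a division, so its differentiability is immediate.
  set l : ℝ → ℝ := fun x => w₂ x * deriv u₁ x - w₁ x * deriv u₂ x with hl
  have hld : Differentiable ℝ l :=
    ((dd hw.smooth₂).mul (dd' hu.smooth₁)).sub ((dd hw.smooth₁).mul (dd' hu.smooth₂))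
  have hWu : ∀ y, u₁ y * deriv u₂ y - u₂ y * deriv u₁ y = -1 := hu.wronskian_eq
  have hWw : ∀ y, w₁ y * deriv w₂ y - w₂ y * deriv w₁ y = -1 := hw.wronskian_eq
  have hpar : ∀ y, w₁ y * u₂ y = w₂ y * u₁ y := by
    intro y
    obtain ⟨h1, e1⟩ := hw.eq_mk y
    obtain ⟨h2, e2⟩ := hu.eq_mk y
    rw [e1, Projectivization.mk_eq_mk_iff'] at e2
    obtain ⟨c, hc⟩ := e2
    have c0 := congrFun hc 0
    have c1 := congrFun hc 1
    simp at c0 c1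
    rw [← c0, ← c1]
    ring
  have h1 : ∀ y, w₁ y = l y * u₁ y := fun y => by
    simp only [hl]
    linear_combination w₁ y * hWu y + deriv u₁ y * hpar y
  have h2 : ∀ y, w₂ y = l y * u₂ y := fun y => by
    simp only [hl]
    linear_combination w₂ y * hWu y + deriv u₂ y * hpar y
  have hsq : ∀ y, l y ^ 2 = 1 := by
    intro y
    have d1 : deriv w₁ y = deriv l y * u₁ y + l y * deriv u₁ y := by
      rw [funext h1]
      exact ((hld y).hasDerivAt.mul (dd hu.smooth₁ y).hasDerivAt).deriv
    have d2 : deriv w₂ y = deriv l y * u₂ y + l y * deriv u₂ y := by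
      rw [funext h2]
      exact ((hld y).hasDerivAt.mul (dd hu.smooth₂ y).hasDerivAt).deriv
    have e := hWw y
    rw [d1, d2, h1, h2] at e
    linear_combination -e + l y ^ 2 * hWu y
  refine ⟨l 0, hsq 0, fun x => ?_, fun x => ?_⟩
  · rw [eq_of_sq_eq_one hld hsq 0 x]; exact h1 x
  · rw [eq_of_sq_eq_one hld hsq 0 x]; exact h2 x

theorem IsNormalizedLift.frame_eq {γ : ℝ → RP1} {u₁ u₂ w₁ w₂ : ℝ → ℝ}
    (hu : IsNormalizedLift γ u₁ u₂) (hw : IsNormalizedLift γ w₁ w₂) (x : ℝ) :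
    (hw.frame x : PSL2) = (hu.frame x : PSL2) := by
  obtain ⟨ε, hε, h1, h2⟩ := hu.eq_or_neg hw
  obtain rfl : w₁ = fun x => ε * u₁ x := funext h1
  obtain rfl : w₂ = fun x => ε * u₂ x := funext h2
  refine psl2_eq_of_smul hε ?_
  ext i j
  fin_cases i <;> fin_cases j <;> simp [IsNormalizedLift.frame, deriv_const_mul_field]

theorem IsNormalizedLift.const_mul {γ : ℝ → RP1} {u₁ u₂ : ℝ → ℝ} {ε : ℝ} (hε : ε ^ 2 = 1)
    (hu : IsNormalizedLift γ u₁ u₂) :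
    IsNormalizedLift γ (fun x => ε * u₁ x) (fun x => ε * u₂ x) where
  smooth₁ := contDiff_const.mul hu.smooth₁
  smooth₂ := contDiff_const.mul hu.smooth₂
  wronskian_eq x := by
    have := hu.wronskian_eq x
    unfold wronskian at this ⊢
    simp only [deriv_const_mul_field]
    linear_combination this + hε * (u₁ x * deriv u₂ x - u₂ x * deriv u₁ x)
  eq_mk x := by
    obtain ⟨h, e⟩ := hu.eq_mk x
    have hne : ε ≠ 0 := fun h0 => by rw [h0] at hε; norm_num at hε
    have e' : ![ε * u₁ x, ε * u₂ x] = ε • ![u₁ x, u₂ x] := by simp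
    have h' : ![ε * u₁ x, ε * u₂ x] ≠ 0 := by rw [e']; exact smul_ne_zero hne h
    refine ⟨h', ?_⟩
    rw [e, eq_comm, Projectivization.mk_eq_mk_iff']
    exact ⟨ε, e'.symm⟩

/-! ### Normalized lifts of smooth curves -/

/-- The normalized lift with the angle `φ`. -/
theorem isNormalizedLift_of_angle {γ : ℝ → RP1} {φ : ℝ → ℝ} (hφ : ContDiff ℝ ∞ φ)
    (hpos : ∀ x, 0 < deriv φ x)
    (hγ : ∀ x, γ x =
      Projectivization.mk ℝ ![Real.sin (φ x), Real.cos (φ x)] (sin_cos_ne_zero _)) :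
    IsNormalizedLift γ (fun x => deriv φ x ^ (-(1 / 2) : ℝ) * Real.sin (φ x))
      (fun x => deriv φ x ^ (-(1 / 2) : ℝ) * Real.cos (φ x)) := by
  have hψ : ContDiff ℝ ∞ (deriv φ) := (contDiff_infty_iff_deriv.1 hφ).2
  set ρ : ℝ → ℝ := fun x => deriv φ x ^ (-(1 / 2) : ℝ) with hρ
  have hρs : ContDiff ℝ ∞ ρ := hψ.rpow_const_of_ne fun x => (hpos x).ne'
  have hρd : ∀ x, HasDerivAt ρ (deriv ρ x) x := fun x =>
    (hρs.differentiable (by simp) x).hasDerivAt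
  have hφd : ∀ x, HasDerivAt φ (deriv φ x) x := fun x =>
    (hφ.differentiable (by simp) x).hasDerivAt
  refine ⟨hρs.mul (Real.contDiff_sin.comp hφ), hρs.mul (Real.contDiff_cos.comp hφ), fun x => ?_,
    fun x => ?_⟩
  · have d1 : deriv (fun x => ρ x * Real.sin (φ x)) x = _ := ((hρd x).mul (hφd x).sin).deriv
    have d2 : deriv (fun x => ρ x * Real.cos (φ x)) x = _ := ((hρd x).mul (hφd x).cos).deriv
    -- The terms with `ρ'` cancel in the Wronskian, which is `-ρ² φ'`; this fixes the exponent
    -- `-1/2` in `ρ`.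
    have hsq : ρ x ^ 2 * deriv φ x = 1 := by
      simp only [hρ]
      rw [← Real.rpow_natCast, ← Real.rpow_mul (hpos x).le]
      norm_num
      rw [Real.rpow_neg_one]
      exact inv_mul_cancel₀ (hpos x).ne'
    unfold wronskian
    rw [d1, d2]
    linear_combination (-(ρ x ^ 2 * deriv φ x)) * Real.sin_sq_add_cos_sq (φ x) - hsq
  · have e : ![ρ x * Real.sin (φ x), ρ x * Real.cos (φ x)] =
        ρ x • ![Real.sin (φ x), Real.cos (φ x)] := by simp
    have hne : ![ρ x * Real.sin (φ x), ρ x * Real.cos (φ x)] ≠ 0 := by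
      rw [e]; exact smul_ne_zero (Real.rpow_pos_of_pos (hpos x) _).ne' (sin_cos_ne_zero _)
    refine ⟨hne, ?_⟩
    rw [hγ x, eq_comm, Projectivization.mk_eq_mk_iff']
    exact ⟨ρ x, e.symm⟩

namespace DevelopingMap

variable {κ : Deck}

/-- A single angle in both variables yields the velocity in `t` and the derivative in `x`, so that
`Θ` becomes a quotient of partial derivatives of one smooth function. -/
theorem exists_curve_angle {c : ℝ → DevelopingMap κ} (hc : IsSmoothCurve c) :
    ∃ φ : ℝ × ℝ → ℝ, ContDiff ℝ ∞ φ ∧ (∀ t x, c t x =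
      Projectivization.mk ℝ ![Real.sin (φ (t, x)), Real.cos (φ (t, x))] (sin_cos_ne_zero _)) ∧
      (∀ t x, 0 < deriv (fun y => φ (t, y)) x) ∧
      ∀ x, theta c x = -(deriv (fun t => φ (t, x)) 0 / deriv (fun y => φ (0, y)) x) := by
  obtain ⟨φ, hφ, h⟩ := exists_smooth_angle hc
  have hx : ∀ t x, angularVelocity (c t) x = deriv (fun y => φ (t, y)) x := fun t x =>
    angularVelocity_sin_cos (fun y => h (t, y))
      (hasDerivAt_comp_prodMk_right hφ t x).differentiableAt.hasDerivAt
  refine ⟨φ, hφ, fun t x => h (t, x), fun t x => ?_, fun x => ?_⟩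
  · rw [← hx]; exact (c t).orientation x
  · unfold theta
    rw [hx, angularVelocity_sin_cos (φ := fun t => φ (t, x)) (fun t => h (t, x))
      (hasDerivAt_comp_prodMk_left hφ 0 x).differentiableAt.hasDerivAt]

theorem contDiff_theta {c : ℝ → DevelopingMap κ} (hc : IsSmoothCurve c) :
    ContDiff ℝ ∞ (theta c) := by
  obtain ⟨φ, hφ, -, hpos, h⟩ := exists_curve_angle hc
  rw [funext h]
  exact ((contDiff_comp_prodMk_right (contDiff_deriv_left hφ) 0).div
    (contDiff_comp_prodMk_right (contDiff_deriv_right hφ) 0) fun x => (hpos 0 x).ne').neg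

/-- A smooth curve of developing maps has a smooth curve of normalized lifts, with
`du/dt = - ℒ_Θ u` at `t = 0`. -/
theorem exists_smooth_lift {c : ℝ → DevelopingMap κ} (hc : IsSmoothCurve c) :
    ∃ U₁ U₂ : ℝ × ℝ → ℝ, ContDiff ℝ ∞ U₁ ∧ ContDiff ℝ ∞ U₂ ∧
      (∀ t, IsNormalizedLift (c t) (fun x => U₁ (t, x)) (fun x => U₂ (t, x))) ∧
      (∀ x, deriv (fun t => U₁ (t, x)) 0 =
        -lieDeriv (-(1 / 2)) (theta c) (fun y => U₁ (0, y)) x) ∧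
      ∀ x, deriv (fun t => U₂ (t, x)) 0 =
        -lieDeriv (-(1 / 2)) (theta c) (fun y => U₂ (0, y)) x := by
  have hv := contDiff_theta hc
  obtain ⟨φ, hφ, hmk, hpos, hθ⟩ := exists_curve_angle hc
  set v := theta c
  have hψ := contDiff_deriv_right hφ
  set ψ : ℝ × ℝ → ℝ := fun p => deriv (fun y => φ (p.1, y)) p.2 with hψdef
  have hψpos : ∀ p, 0 < ψ p := fun p => hpos p.1 p.2
  set ρ : ℝ × ℝ → ℝ := fun p => ψ p ^ (-(1 / 2) : ℝ) with hρdef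
  have hρ : ContDiff ℝ ∞ ρ := hψ.rpow_const_of_ne fun p => (hψpos p).ne'
  have hφt : ∀ x, HasDerivAt (fun t => φ (t, x)) (-(v x * ψ (0, x))) 0 := by
    intro x
    have h1 := (hasDerivAt_comp_prodMk_left hφ 0 x).differentiableAt.hasDerivAt
    refine h1.congr_deriv ?_
    rw [hθ x]
    have := (hψpos (0, x)).ne'
    simp only [hψdef] at this ⊢
    field_simp
  have hφx : ∀ x, HasDerivAt (fun y => φ (0, y)) (ψ (0, x)) x := fun x =>
    (hasDerivAt_comp_prodMk_right hφ 0 x).differentiableAt.hasDerivAt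
  have hvd : ∀ x, HasDerivAt v (deriv v x) x := fun x =>
    (hv.differentiable (by simp) x).hasDerivAt
  have hψx : ∀ x, HasDerivAt (fun y => ψ (0, y)) (deriv (fun y => ψ (0, y)) x) x := fun x =>
    (hasDerivAt_comp_prodMk_right hψ 0 x).differentiableAt.hasDerivAt
  -- Exchanging the partial derivatives turns `∂φ/∂t = -v ψ` into `∂ψ/∂t = -(v ψ)'`. Thus `ψ = φ'`
  -- varies by `-ℒ_v` as a 1-density and `ρ = ψ^(-1/2)` as a `-1/2`-density, while `φ` varies as a
  -- function.
  have hψt : ∀ x, HasDerivAt (fun t => ψ (t, x))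
      (-(deriv v x * ψ (0, x) + v x * deriv (fun y => ψ (0, y)) x)) 0 := by
    intro x
    have h1 := hasDerivAt_deriv_right hφ 0 x
    rw [show (fun y => deriv (fun s => φ (s, y)) 0) = fun y => -(v y * ψ (0, y)) from
      funext fun y => (hφt y).deriv] at h1
    exact h1.congr_deriv ((hvd x).mul (hψx x)).neg.deriv
  have hρx : ∀ x, HasDerivAt (fun y => ρ (0, y)) (-(1 / 2) * ρ (0, x) / ψ (0, x) *
      deriv (fun y => ψ (0, y)) x) x := by
    intro x
    have h1 := (hψx x).rpow_const (p := (-(1 / 2) : ℝ)) (Or.inl (hψpos (0, x)).ne')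
    refine h1.congr_deriv ?_
    simp only [hρdef]
    rw [Real.rpow_sub_one (hψpos (0, x)).ne']
    ring
  have hρt : ∀ x, HasDerivAt (fun t => ρ (t, x)) (-(1 / 2) * ρ (0, x) / ψ (0, x) *
      -(deriv v x * ψ (0, x) + v x * deriv (fun y => ψ (0, y)) x)) 0 := by
    intro x
    have h1 := (hψt x).rpow_const (p := (-(1 / 2) : ℝ)) (Or.inl (hψpos (0, x)).ne')
    refine h1.congr_deriv ?_
    simp only [hρdef]
    rw [Real.rpow_sub_one (hψpos (0, x)).ne']
    ring
  refine ⟨fun p => ρ p * Real.sin (φ p), fun p => ρ p * Real.cos (φ p),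
    hρ.mul (Real.contDiff_sin.comp hφ), hρ.mul (Real.contDiff_cos.comp hφ), fun t =>
    isNormalizedLift_of_angle (contDiff_comp_prodMk_right hφ t) (hpos t) (hmk t),
    fun x => ?_, fun x => ?_⟩
  · have h1 : deriv (fun t => ρ (t, x) * Real.sin (φ (t, x))) 0 = _ :=
      ((hρt x).mul (hφt x).sin).deriv
    have h2 : deriv (fun y => ρ (0, y) * Real.sin (φ (0, y))) x = _ :=
      ((hρx x).mul (hφx x).sin).deriv
    have := (hψpos (0, x)).ne'
    unfold lieDeriv
    rw [h1, h2]
    field_simp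
    ring
  · have h1 : deriv (fun t => ρ (t, x) * Real.cos (φ (t, x))) 0 = _ :=
      ((hρt x).mul (hφt x).cos).deriv
    have h2 : deriv (fun y => ρ (0, y) * Real.cos (φ (0, y))) x = _ :=
      ((hρx x).mul (hφx x).cos).deriv
    have := (hψpos (0, x)).ne'
    unfold lieDeriv
    rw [h1, h2]
    field_simp
    ring

/-- The smooth curve of normalized lifts may be chosen to start at a given normalized lift. -/
theorem exists_smooth_lift_of_isNormalizedLift {c : ℝ → DevelopingMap κ} (hc : IsSmoothCurve c)
    {u₁ u₂ : ℝ → ℝ} (hu : IsNormalizedLift (c 0) u₁ u₂) :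
    ∃ U₁ U₂ : ℝ × ℝ → ℝ, ContDiff ℝ ∞ U₁ ∧ ContDiff ℝ ∞ U₂ ∧
      (∀ t, IsNormalizedLift (c t) (fun x => U₁ (t, x)) (fun x => U₂ (t, x))) ∧
      (∀ x, U₁ (0, x) = u₁ x) ∧ (∀ x, U₂ (0, x) = u₂ x) ∧
      (∀ x, deriv (fun t => U₁ (t, x)) 0 = -lieDeriv (-(1 / 2)) (theta c) u₁ x) ∧
      ∀ x, deriv (fun t => U₂ (t, x)) 0 = -lieDeriv (-(1 / 2)) (theta c) u₂ x := by
  obtain ⟨U₁, U₂, h1, h2, hl, hd1, hd2⟩ := exists_smooth_lift hc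
  obtain ⟨ε, hε, e1, e2⟩ := (hl 0).eq_or_neg hu
  have hlie : ∀ (v f : ℝ → ℝ) (x : ℝ), lieDeriv (-(1 / 2)) v (fun y => ε * f y) x =
      ε * lieDeriv (-(1 / 2)) v f x := fun v f x => by
    unfold lieDeriv
    rw [deriv_const_mul_field]
    ring
  refine ⟨fun p => ε * U₁ p, fun p => ε * U₂ p, contDiff_const.mul h1, contDiff_const.mul h2,
    fun t => (hl t).const_mul hε, fun x => (e1 x).symm, fun x => (e2 x).symm, fun x => ?_,
    fun x => ?_⟩
  · rw [funext e1, hlie, deriv_const_mul_field, hd1]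
    ring
  · rw [funext e2, hlie, deriv_const_mul_field, hd2]
    ring

end DevelopingMap

/-- The lifts chosen in `iotaHat` may change sign arbitrarily with `t`, but their classes in `PSL2`
do not see the sign. The frames of a smooth family of lifts therefore represent the same sections.
-/
theorem isSmoothCurve_iotaHat {κ : Deck} {c : ℝ → DevelopingMap κ}
    (hc : DevelopingMap.IsSmoothCurve c) :
    QuasiPeriodicSection.IsSmoothCurve (fun t => iotaHat (c t)) := by
  obtain ⟨U₁, U₂, h1, h2, hl, -, -⟩ := DevelopingMap.exists_smooth_lift hc
  intro p
  refine ⟨fun q => (hl q.1).frame q.2, fun i j => ?_, Filter.Eventually.of_forall fun q =>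
    (hl q.1).frame_eq (c q.1).lift_spec q.2⟩
  fin_cases i <;> fin_cases j
  · exact (contDiff_deriv_right h1).contDiffAt
  · exact (contDiff_deriv_right h2).contDiffAt
  · exact h1.contDiffAt
  · exact h2.contDiffAt

/-! ### Derivatives of curves of matrices -/

/-- The curve `M` of matrices has the derivative `M'` at `t`, entry by entry. -/
def HasEntryDerivAt (M : ℝ → Matrix (Fin 2) (Fin 2) ℝ) (M' : Matrix (Fin 2) (Fin 2) ℝ) (t : ℝ) :
    Prop :=
  ∀ i j, HasDerivAt (fun s => M s i j) (M' i j) t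

namespace HasEntryDerivAt

variable {M N : ℝ → Matrix (Fin 2) (Fin 2) ℝ} {M' N' : Matrix (Fin 2) (Fin 2) ℝ} {t : ℝ}

theorem const (A : Matrix (Fin 2) (Fin 2) ℝ) (t : ℝ) : HasEntryDerivAt (fun _ => A) 0 t :=
  fun i j => hasDerivAt_const t (A i j)

theorem mul (hM : HasEntryDerivAt M M' t) (hN : HasEntryDerivAt N N' t) :
    HasEntryDerivAt (fun s => M s * N s) (M' * N t + M t * N') t := by
  intro i j
  simp only [Matrix.mul_apply, Fin.sum_univ_two, Matrix.add_apply]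
  refine (((hM i 0).mul (hN 0 j)).add ((hM i 1).mul (hN 1 j))).congr_deriv ?_
  ring

theorem const_mul (A : Matrix (Fin 2) (Fin 2) ℝ) (hN : HasEntryDerivAt N N' t) :
    HasEntryDerivAt (fun s => A * N s) (A * N') t := by
  simpa using (const A t).mul hN

theorem mul_const (hM : HasEntryDerivAt M M' t) (A : Matrix (Fin 2) (Fin 2) ℝ) :
    HasEntryDerivAt (fun s => M s * A) (M' * A) t := by
  simpa using hM.mul (const A t)

theorem sub_const (hM : HasEntryDerivAt M M' t) (A : Matrix (Fin 2) (Fin 2) ℝ) :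
    HasEntryDerivAt (fun s => M s - A) M' t :=
  fun i j => (hM i j).sub_const (A i j)

theorem unique (h : HasEntryDerivAt M M' t) (h' : HasEntryDerivAt M N' t) : M' = N' := by
  ext i j
  exact (h i j).unique (h' i j)

theorem comp {κ : ℝ → ℝ} {κ' x : ℝ} (hM : HasEntryDerivAt M M' (κ x)) (hκ : HasDerivAt κ κ' x) :
    HasEntryDerivAt (fun y => M (κ y)) (κ' • M') x := by
  intro i j
  refine ((hM i j).comp x hκ).congr_deriv ?_
  simp [mul_comm]

theorem inv {g : ℝ → SL2} (hg : HasEntryDerivAt (fun s => (g s : Matrix (Fin 2) (Fin 2) ℝ)) M' t) :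
    HasEntryDerivAt (fun s => (((g s)⁻¹ : SL2) : Matrix (Fin 2) (Fin 2) ℝ))
      (-(((g t)⁻¹ : SL2) * M' * ((g t)⁻¹ : SL2))) t := by
  -- In `SL2` the inverse is the adjugate, whose entries are linear in those of `g`.
  -- Differentiability is thus clear, and the invariant formula follows by differentiating `g g⁻¹ =
  -- 1`.
  have h1 : HasEntryDerivAt (fun s => (((g s)⁻¹ : SL2) : Matrix (Fin 2) (Fin 2) ℝ))
      !![M' 1 1, -M' 0 1; -M' 1 0, M' 0 0] t := by
    intro i j
    simp only [Matrix.SpecialLinearGroup.coe_inv, Matrix.adjugate_fin_two]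
    fin_cases i <;> fin_cases j
    · exact hg 1 1
    · exact (hg 0 1).neg
    · exact (hg 1 0).neg
    · exact hg 0 0
  have h2 := hg.mul h1
  simp only [← Matrix.SpecialLinearGroup.coe_mul, mul_inv_cancel] at h2
  have h3 := h2.unique (const _ t)
  rwa [mul_assoc, eq_neg_of_add_eq_zero_left h3, mul_neg, neg_neg, ← mul_assoc,
    ← Matrix.SpecialLinearGroup.coe_mul, inv_mul_cancel, Matrix.SpecialLinearGroup.coe_one,
    one_mul]

end HasEntryDerivAt

theorem maurerCartan_eq_of_hasEntryDerivAt {c : ℝ → PSL2} {g : ℝ → SL2}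
    {M' : Matrix (Fin 2) (Fin 2) ℝ} (hc : ∀ t, c t = (g t : PSL2))
    (hg : HasEntryDerivAt (fun t => (g t : Matrix (Fin 2) (Fin 2) ℝ)) M' 0) :
    maurerCartan c = (((g 0)⁻¹ : SL2) : Matrix (Fin 2) (Fin 2) ℝ) * M' := by
  rw [maurerCartan_eq (g := g) ⟨fun i j => (hg i j).differentiableAt, .of_forall hc⟩]
  unfold logDerivAtZero
  congr 1
  ext i j
  exact (hg i j).deriv

theorem coe_mul_coe_inv (g : SL2) :
    (g : Matrix (Fin 2) (Fin 2) ℝ) * ((g⁻¹ : SL2) : Matrix (Fin 2) (Fin 2) ℝ) = 1 := by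
  rw [← Matrix.SpecialLinearGroup.coe_mul, mul_inv_cancel, Matrix.SpecialLinearGroup.coe_one]

theorem coe_inv_mul_coe (g : SL2) :
    ((g⁻¹ : SL2) : Matrix (Fin 2) (Fin 2) ℝ) * (g : Matrix (Fin 2) (Fin 2) ℝ) = 1 := by
  rw [← Matrix.SpecialLinearGroup.coe_mul, inv_mul_cancel, Matrix.SpecialLinearGroup.coe_one]

/-! ### Symmetry and invariance of the trace metric -/

theorem metric_comm (X Y : Matrix (Fin 2) (Fin 2) ℝ) : metric X Y = metric Y X := by
  unfold metric
  rw [Matrix.trace_mul_comm]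

theorem metric_sub_left (X Y Z : Matrix (Fin 2) (Fin 2) ℝ) :
    metric (X - Y) Z = metric X Z - metric Y Z := by
  unfold metric
  rw [sub_mul, Matrix.trace_sub, mul_sub]

theorem metric_smul_right (a : ℝ) (X Y : Matrix (Fin 2) (Fin 2) ℝ) :
    metric X (a • Y) = a * metric X Y := by
  unfold metric
  rw [Matrix.mul_smul, Matrix.trace_smul, smul_eq_mul]
  ring

theorem metric_conj (g : SL2) (X Y : Matrix (Fin 2) (Fin 2) ℝ) :
    metric (g * X * (g⁻¹ : SL2)) (g * Y * (g⁻¹ : SL2)) = metric X Y := by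
  unfold metric
  rw [show (g : Matrix (Fin 2) (Fin 2) ℝ) * X * (g⁻¹ : SL2) * (g * Y * (g⁻¹ : SL2)) =
    g * (X * (((g⁻¹ : SL2) : Matrix (Fin 2) (Fin 2) ℝ) * g) * Y * (g⁻¹ : SL2)) by
      simp only [mul_assoc], Matrix.trace_mul_comm, coe_inv_mul_coe, mul_one, mul_assoc,
    coe_inv_mul_coe, mul_one]

theorem metric_conj_inv (g : SL2) (X Y : Matrix (Fin 2) (Fin 2) ℝ) :
    metric ((g⁻¹ : SL2) * X * g) ((g⁻¹ : SL2) * Y * g) = metric X Y := by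
  simpa using metric_conj g⁻¹ X Y

theorem metric_eq_sum (X Y : Matrix (Fin 2) (Fin 2) ℝ) :
    metric X Y = 2 * (X 0 0 * Y 0 0 + X 0 1 * Y 1 0 + (X 1 0 * Y 0 1 + X 1 1 * Y 1 1)) := by
  simp [metric, Matrix.trace, Matrix.mul_apply, Fin.sum_univ_two]

theorem HasEntryDerivAt.metric_const {M : ℝ → Matrix (Fin 2) (Fin 2) ℝ}
    {M' : Matrix (Fin 2) (Fin 2) ℝ} {t : ℝ} (hM : HasEntryDerivAt M M' t)
    (Y : Matrix (Fin 2) (Fin 2) ℝ) : HasDerivAt (fun s => metric (M s) Y) (metric M' Y) t := by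
  simp only [metric_eq_sum]
  exact ((((hM 0 0).mul_const _).add ((hM 0 1).mul_const _)).add
    (((hM 1 0).mul_const _).add ((hM 1 1).mul_const _))).const_mul 2

/-! ### Independence of the base point -/

/-- For curves `X₁, X₂` of matrices with `X (κ x) = h (X x - θ) h⁻¹`, the expression
`- 1/2 ∫_x^{κ x} ⟨X ∧ X'⟩ + 1/2 ⟨X_x ∧ θ⟩` does not depend on `x`. -/
theorem baseChange_eq (κ : Deck) {X₁ X₂ X₁' X₂' : ℝ → Matrix (Fin 2) (Fin 2) ℝ}
    {θ₁ θ₂ : Matrix (Fin 2) (Fin 2) ℝ} (h : SL2)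
    (hX₁ : ∀ x, HasEntryDerivAt X₁ (X₁' x) x) (hX₂ : ∀ x, HasEntryDerivAt X₂ (X₂' x) x)
    (hθ₁ : ∀ x, X₁ (κ x) = h * (X₁ x - θ₁) * (h⁻¹ : SL2))
    (hθ₂ : ∀ x, X₂ (κ x) = h * (X₂ x - θ₂) * (h⁻¹ : SL2))
    (hc : Continuous fun x => metric (X₁ x) (X₂' x) - metric (X₂ x) (X₁' x)) (x y : ℝ) :
    -(1 / 2) * (∫ s in x..κ x, (metric (X₁ s) (X₂' s) - metric (X₂ s) (X₁' s))) +
        (1 / 2) * (metric (X₁ x) θ₂ - metric (X₂ x) θ₁) =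
      -(1 / 2) * (∫ s in y..κ y, (metric (X₁ s) (X₂' s) - metric (X₂ s) (X₁' s))) +
        (1 / 2) * (metric (X₁ y) θ₂ - metric (X₂ y) θ₁) := by
  set f : ℝ → ℝ := fun s => metric (X₁ s) (X₂' s) - metric (X₂ s) (X₁' s) with hf
  have hκ : ∀ x, HasDerivAt κ (deriv κ x) x := fun x =>
    (κ.smooth.differentiable (by simp) x).hasDerivAt
  have hder : ∀ {X X' : ℝ → Matrix (Fin 2) (Fin 2) ℝ} {θ : Matrix (Fin 2) (Fin 2) ℝ},
      (∀ x, HasEntryDerivAt X (X' x) x) → (∀ x, X (κ x) = h * (X x - θ) * (h⁻¹ : SL2)) →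
      ∀ x, deriv κ x • X' (κ x) = h * X' x * (h⁻¹ : SL2) := by
    intro X X' θ hX hθ x
    refine ((hX (κ x)).comp (hκ x)).unique ?_
    simp only [hθ]
    exact (((hX x).sub_const θ).const_mul h).mul_const _
  -- Differentiating the equivariance of `X` removes the constant `θ`, and the conjugation by `h`
  -- disappears in the metric; so `κ^*` of the integrand differs from the integrand only by terms
  -- `⟨θ, X'⟩`.
  have hfκ : ∀ x, f (κ x) * deriv κ x =
      metric (X₁ x - θ₁) (X₂' x) - metric (X₂ x - θ₂) (X₁' x) := by
    intro x
    rw [mul_comm]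
    simp only [hf]
    rw [mul_sub, ← metric_smul_right, ← metric_smul_right, hder hX₁ hθ₁, hder hX₂ hθ₂, hθ₁, hθ₂,
      metric_conj, metric_conj]
  -- The integral is split at `0` so that each part can be differentiated in its upper limit. By
  -- `hfκ` the integrals contribute `1/2 (⟨θ₁, X₂'⟩ - ⟨θ₂, X₁'⟩)` to `P'`, which the derivative of
  -- the boundary term cancels.
  set P : ℝ → ℝ := fun x => -(1 / 2) * ((∫ s in (0 : ℝ)..κ x, f s) - ∫ s in (0 : ℝ)..x, f s) +
    (1 / 2) * (metric (X₁ x) θ₂ - metric (X₂ x) θ₁) with hP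
  have hint : ∀ x, HasDerivAt (fun z => ∫ s in (0 : ℝ)..z, f s) (f x) x := fun x =>
    intervalIntegral.integral_hasDerivAt_right (hc.intervalIntegrable 0 x)
      hc.aestronglyMeasurable.stronglyMeasurableAtFilter hc.continuousAt
  have hPd : ∀ x, HasDerivAt P 0 x := by
    intro x
    have h1 := ((((hint (κ x)).comp x (hκ x)).sub (hint x)).const_mul (-(1 / 2))).add
      ((((hX₁ x).metric_const θ₂).sub ((hX₂ x).metric_const θ₁)).const_mul (1 / 2))
    refine h1.congr_deriv ?_
    rw [hfκ, metric_sub_left, metric_sub_left, metric_comm θ₁, metric_comm θ₂]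
    simp only [hf]
    ring
  have hPe : ∀ x, P x = -(1 / 2) * (∫ s in x..κ x, f s) +
      (1 / 2) * (metric (X₁ x) θ₂ - metric (X₂ x) θ₁) := by
    intro x
    simp only [hP]
    rw [intervalIntegral.integral_interval_sub_left (hc.intervalIntegrable _ _)
      (hc.intervalIntegrable _ _)]
  rw [← hPe, ← hPe]
  exact is_const_of_deriv_eq_zero (fun x => (hPd x).differentiableAt) (fun x => (hPd x).deriv) x y

/-! ### Frames of solutions of the Hill equation -/

theorem iteratedDeriv_two_eq (f : ℝ → ℝ) : iteratedDeriv 2 f = deriv (deriv f) := by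
  rw [iteratedDeriv_succ, iteratedDeriv_one]

theorem iteratedDeriv_three_eq (f : ℝ → ℝ) : iteratedDeriv 3 f = deriv (deriv (deriv f)) := by
  rw [iteratedDeriv_succ, iteratedDeriv_two_eq]

theorem contDiff_deriv {f : ℝ → ℝ} (hf : ContDiff ℝ ∞ f) : ContDiff ℝ ∞ (deriv f) :=
  (contDiff_infty_iff_deriv.1 hf).2

theorem hasDerivAt_of_contDiff {f : ℝ → ℝ} (hf : ContDiff ℝ ∞ f) (x : ℝ) :
    HasDerivAt f (deriv f x) x :=
  (hf.differentiable (by simp) x).hasDerivAt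

/-- The matrix with columns `j¹_x(u₁)` and `j¹_x(u₂)`. -/
def jetFrame (u₁ u₂ : ℝ → ℝ) (x : ℝ) : Matrix (Fin 2) (Fin 2) ℝ :=
  !![deriv u₁ x, deriv u₂ x; u₁ x, u₂ x]

theorem IsNormalizedLift.coe_frame {γ : ℝ → RP1} {u₁ u₂ : ℝ → ℝ} (h : IsNormalizedLift γ u₁ u₂)
    (x : ℝ) : (h.frame x : Matrix (Fin 2) (Fin 2) ℝ) = jetFrame u₁ u₂ x := rfl

/-- The matrix of `- ℒ_v` acting on the `1`-jets of the solutions of the Hill equation with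
potential `T`. -/
def lieMatrix (T v : ℝ → ℝ) (x : ℝ) : Matrix (Fin 2) (Fin 2) ℝ :=
  !![-(1 / 2) * deriv v x, T x * v x + (1 / 2) * deriv (deriv v) x; -v x, (1 / 2) * deriv v x]

theorem hasEntryDerivAt_jetFrame {u₁ u₂ : ℝ → ℝ} (h₁ : ContDiff ℝ ∞ u₁) (h₂ : ContDiff ℝ ∞ u₂)
    (x : ℝ) : HasEntryDerivAt (jetFrame u₁ u₂)
      !![deriv (deriv u₁) x, deriv (deriv u₂) x; deriv u₁ x, deriv u₂ x] x := by
  intro i j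
  fin_cases i <;> fin_cases j
  · exact hasDerivAt_of_contDiff (contDiff_deriv h₁) x
  · exact hasDerivAt_of_contDiff (contDiff_deriv h₂) x
  · exact hasDerivAt_of_contDiff h₁ x
  · exact hasDerivAt_of_contDiff h₂ x

/-- The Hill equation eliminates `u''`, so the 1-jet of `-ℒ_v u` depends on the 1-jet of `u` alone.
This is what makes `lieMatrix` possible. -/
theorem deriv_neg_lieDeriv {T v u : ℝ → ℝ} (hv : ContDiff ℝ ∞ v) (hu : ContDiff ℝ ∞ u)
    (hT : ∀ x, deriv (deriv u) x = -(T x * u x)) (x : ℝ) :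
    deriv (fun y => -lieDeriv (-(1 / 2)) v u y) x =
      -(1 / 2) * deriv v x * deriv u x + (T x * v x + (1 / 2) * deriv (deriv v) x) * u x := by
  have h1 : deriv (fun y => -lieDeriv (-(1 / 2)) v u y) x = _ :=
    (((hasDerivAt_of_contDiff hv x).mul (hasDerivAt_of_contDiff (contDiff_deriv hu) x)).add
      (((hasDerivAt_of_contDiff (contDiff_deriv hv) x).const_mul (-(1 / 2))).mul
        (hasDerivAt_of_contDiff hu x))).neg.deriv
  rw [h1, hT]
  ring

theorem jetFrame_neg_lieDeriv {T v u₁ u₂ : ℝ → ℝ} (hv : ContDiff ℝ ∞ v) (h₁ : ContDiff ℝ ∞ u₁)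
    (h₂ : ContDiff ℝ ∞ u₂) (hT₁ : ∀ x, deriv (deriv u₁) x = -(T x * u₁ x))
    (hT₂ : ∀ x, deriv (deriv u₂) x = -(T x * u₂ x)) (x : ℝ) :
    jetFrame (fun y => -lieDeriv (-(1 / 2)) v u₁ y) (fun y => -lieDeriv (-(1 / 2)) v u₂ y) x =
      lieMatrix T v x * jetFrame u₁ u₂ x := by
  unfold jetFrame
  rw [deriv_neg_lieDeriv hv h₁ hT₁, deriv_neg_lieDeriv hv h₂ hT₂]
  ext i j
  fin_cases i <;> fin_cases j <;>
    simp [lieMatrix, lieDeriv, Matrix.mul_apply, Fin.sum_univ_two] <;> ring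

/-- The commutator formula behind the derivative of `g⁻¹ A g` for the frame `g` of solutions. -/
theorem hasEntryDerivAt_lieMatrix {T v : ℝ → ℝ} (hT : ContDiff ℝ ∞ T) (hv : ContDiff ℝ ∞ v)
    (x : ℝ) : HasEntryDerivAt (lieMatrix T v)
      (!![0, -hillD T v x; 0, 0] + !![0, -T x; 1, 0] * lieMatrix T v x -
        lieMatrix T v x * !![0, -T x; 1, 0]) x := by
  have d0 := hasDerivAt_of_contDiff hv x
  have d1 := hasDerivAt_of_contDiff (contDiff_deriv hv) x
  have d2 := hasDerivAt_of_contDiff (contDiff_deriv (contDiff_deriv hv)) x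
  have dT := hasDerivAt_of_contDiff hT x
  intro i j
  fin_cases i <;> fin_cases j
  · refine (d1.const_mul (-(1 / 2))).congr_deriv ?_
    simp [lieMatrix]
  · refine ((dT.mul d0).add (d2.const_mul (1 / 2))).congr_deriv ?_
    simp [lieMatrix, hillD, iteratedDeriv_three_eq]
    ring
  · refine d0.neg.congr_deriv ?_
    simp [lieMatrix]
    ring
  · refine (d1.const_mul (1 / 2)).congr_deriv ?_
    simp [lieMatrix]
    ring

/-- Source of the boundary term: it turns the pairing of `Ξ` with `q^* θ^L` into values of `B_L`. -/
theorem metric_lieMatrix (T v w : ℝ → ℝ) (x : ℝ) :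
    metric (lieMatrix T v x) (lieMatrix T w x) = -(2 * concomitant T x v w) := by
  rw [metric_eq_sum]
  simp [lieMatrix, concomitant, iteratedDeriv_two_eq]
  ring

/-- Source of the integrand: against a matrix with only an upper right entry, the trace sees only
the lower left entry `-v` of `lieMatrix`. -/
theorem metric_lieMatrix_single (T v : ℝ → ℝ) (x d : ℝ) :
    metric (lieMatrix T v x) !![0, -d; 0, 0] = 2 * (v x * d) := by
  rw [metric_eq_sum]
  simp [lieMatrix]

theorem jetFrame_pullback (κ : Deck) {u₁ u₂ : ℝ → ℝ} (h₁ : ContDiff ℝ ∞ u₁)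
    (h₂ : ContDiff ℝ ∞ u₂) (x : ℝ) :
    jetFrame (κ.pullback (-(1 / 2)) u₁) (κ.pullback (-(1 / 2)) u₂) x =
      (κ.jetMap x : Matrix (Fin 2) (Fin 2) ℝ) * jetFrame u₁ u₂ (κ x) := by
  have j1 := jet_pullback κ h₁ x
  have j2 := jet_pullback κ h₂ x
  ext i j
  rw [Matrix.mul_apply, Fin.sum_univ_two]
  have j1i := congrFun j1 i
  have j2i := congrFun j2 i
  simp only [Matrix.mulVec, dotProduct, Fin.sum_univ_two] at j1i j2i
  fin_cases i <;> fin_cases j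
  · exact j1i
  · exact j2i
  · exact j1i
  · exact j2i

theorem contDiff_pullback (κ : Deck) (r : ℝ) {f : ℝ → ℝ} (hf : ContDiff ℝ ∞ f) :
    ContDiff ℝ ∞ (κ.pullback r f) :=
  ((contDiff_deriv κ.smooth).rpow_const_of_ne fun x => (κ.deriv_pos x).ne').mul
    (hf.comp κ.smooth)

/-- The pull-back commutes with the Lie derivative of `-1/2`-densities. -/
theorem pullback_lieDeriv (κ : Deck) {v u : ℝ → ℝ} (hv : ContDiff ℝ ∞ v) (hu : ContDiff ℝ ∞ u)
    (x : ℝ) : κ.pullback (-(1 / 2)) (fun y => -lieDeriv (-(1 / 2)) v u y) x =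
      -lieDeriv (-(1 / 2)) (κ.pullback (-1) v) (κ.pullback (-(1 / 2)) u) x := by
  have hp := κ.deriv_pos x
  have hk := hasDerivAt_of_contDiff κ.smooth x
  have hk' := hasDerivAt_of_contDiff (contDiff_deriv κ.smooth) x
  have hv' := (hasDerivAt_of_contDiff hv (κ x)).comp x hk
  have hu' := (hasDerivAt_of_contDiff hu (κ x)).comp x hk
  have e1 : deriv (κ.pullback (-1) v) x = _ :=
    ((hk'.rpow_const (p := (-1 : ℝ)) (Or.inl hp.ne')).mul hv').deriv
  have e2 : deriv (κ.pullback (-(1 / 2)) u) x = _ :=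
    ((hk'.rpow_const (p := (-(1 / 2) : ℝ)) (Or.inl hp.ne')).mul hu').deriv
  unfold lieDeriv
  rw [e1, e2]
  simp only [Deck.pullback, Function.comp_apply]
  rw [Real.rpow_sub_one hp.ne', Real.rpow_sub_one hp.ne', Real.rpow_neg_one]
  field_simp
  ring

/-! ### The frame of a developing map -/

namespace DevelopingMap

variable {κ : Deck}

/-- The frame of the normalized lift of a developing map. -/
def frame (γ : DevelopingMap κ) (x : ℝ) : SL2 := γ.lift_spec.frame x

theorem coe_frame (γ : DevelopingMap κ) (x : ℝ) :
    (γ.frame x : Matrix (Fin 2) (Fin 2) ℝ) = jetFrame γ.lift.1 γ.lift.2 x := rfl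

theorem contDiff_potential (γ : DevelopingMap κ) : ContDiff ℝ ∞ γ.potential := by
  have h1 := γ.lift_spec.smooth₁
  have h2 := γ.lift_spec.smooth₂
  unfold potential
  rw [iteratedDeriv_two_eq, iteratedDeriv_two_eq]
  exact ((contDiff_deriv (contDiff_deriv h1)).mul (contDiff_deriv h2)).sub
    ((contDiff_deriv (contDiff_deriv h2)).mul (contDiff_deriv h1))

/-- The normalized lift solves the Hill equation. -/
theorem hill_lift (γ : DevelopingMap κ) :
    (∀ x, deriv (deriv γ.lift.1) x = -(γ.potential x * γ.lift.1 x)) ∧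
      ∀ x, deriv (deriv γ.lift.2) x = -(γ.potential x * γ.lift.2 x) := by
  have h1 := γ.lift_spec.smooth₁
  have h2 := γ.lift_spec.smooth₂
  have hW : ∀ x, γ.lift.1 x * deriv γ.lift.2 x - γ.lift.2 x * deriv γ.lift.1 x = -1 :=
    γ.lift_spec.wronskian_eq
  -- This is the derivative of the constant Wronskian.
  have hW' : ∀ x, γ.lift.1 x * deriv (deriv γ.lift.2) x =
      γ.lift.2 x * deriv (deriv γ.lift.1) x := by
    intro x
    have d := ((hasDerivAt_of_contDiff h1 x).mul
      (hasDerivAt_of_contDiff (contDiff_deriv h2) x)).sub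
      ((hasDerivAt_of_contDiff h2 x).mul (hasDerivAt_of_contDiff (contDiff_deriv h1) x))
    have e := d.unique ((hasDerivAt_const x (-1 : ℝ)).congr_of_eventuallyEq (.of_forall hW))
    linear_combination e
  constructor <;> intro x <;> simp only [potential, iteratedDeriv_two_eq]
  · linear_combination deriv (deriv γ.lift.1) x * hW x - deriv γ.lift.1 x * hW' x
  · linear_combination deriv (deriv γ.lift.2) x * hW x - deriv γ.lift.2 x * hW' x

theorem hasEntryDerivAt_frame (γ : DevelopingMap κ) (x : ℝ) :
    HasEntryDerivAt (fun y => (γ.frame y : Matrix (Fin 2) (Fin 2) ℝ))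
      (!![0, -γ.potential x; 1, 0] * γ.frame x) x := by
  have h := hasEntryDerivAt_jetFrame γ.lift_spec.smooth₁ γ.lift_spec.smooth₂ x
  rw [γ.hill_lift.1, γ.hill_lift.2] at h
  have e : !![0, -γ.potential x; 1, 0] * jetFrame γ.lift.1 γ.lift.2 x =
      !![-(γ.potential x * γ.lift.1 x), -(γ.potential x * γ.lift.2 x);
        deriv γ.lift.1 x, deriv γ.lift.2 x] := by
    ext i j
    fin_cases i <;> fin_cases j <;> simp [jetFrame]
  rw [coe_frame, e]
  exact h

/-- A representative in `SL(2, ℝ)` of the monodromy of a developing map. -/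
theorem exists_frame_monodromy (γ : DevelopingMap κ) :
    ∃ h : SL2, ∀ x, κ.jetMap x * γ.frame (κ x) * h = γ.frame x := by
  have h1 := γ.lift_spec.smooth₁
  have h2 := γ.lift_spec.smooth₂
  set F : ℝ → SL2 := fun x => κ.jetMap x * γ.frame (κ x) with hF
  -- The product `F` is the frame of the pulled-back densities, which are smooth, so the entries of
  -- `jetMap` need not be differentiated.
  have hFd : ∀ x, ∃ F', HasEntryDerivAt (fun y => (F y : Matrix (Fin 2) (Fin 2) ℝ)) F' x := by
    intro x
    have e : (fun y => (F y : Matrix (Fin 2) (Fin 2) ℝ)) =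
        jetFrame (κ.pullback (-(1 / 2)) γ.lift.1) (κ.pullback (-(1 / 2)) γ.lift.2) := by
      funext y
      rw [jetFrame_pullback κ h1 h2, hF, Matrix.SpecialLinearGroup.coe_mul, coe_frame]
    rw [e]
    exact ⟨_, hasEntryDerivAt_jetFrame (contDiff_pullback κ _ h1) (contDiff_pullback κ _ h2) x⟩
  obtain ⟨B, hB⟩ := QuotientGroup.mk_surjective (iotaHat γ).quasiPeriodic.choose
  have hspec := (iotaHat γ).quasiPeriodic.choose_spec
  rw [← hB] at hspec
  -- the scalar matrices `M x` have constant sign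
  set M : ℝ → SL2 := fun x => (γ.frame x)⁻¹ * F x * B with hM
  have hMs : ∀ x, ∃ r : ℝ, r ^ 2 = 1 ∧
      (M x : Matrix (Fin 2) (Fin 2) ℝ) = Matrix.scalar (Fin 2) r := by
    intro x
    have e : ((κ.jetMap x * γ.frame (κ x) : SL2) : PSL2) = ((γ.frame x * B⁻¹ : SL2) : PSL2) :=
      hspec x
    have e' : ((1 : SL2) : PSL2) = (M x : PSL2) := by
      simp only [hM, hF, QuotientGroup.mk_mul, QuotientGroup.mk_inv, QuotientGroup.mk_one] at e ⊢
      rw [e]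
      simp
    have h4 := QuotientGroup.eq.1 e'
    rw [Matrix.SpecialLinearGroup.mem_center_iff] at h4
    obtain ⟨r, hr, hr'⟩ := h4
    refine ⟨r, by simpa using hr, ?_⟩
    rw [hr']
    simp
  have hMd : Differentiable ℝ (fun x => (M x : Matrix (Fin 2) (Fin 2) ℝ) 0 0) := by
    intro x
    obtain ⟨F', hF'⟩ := hFd x
    have := ((γ.hasEntryDerivAt_frame x).inv.mul hF').mul_const (B : Matrix (Fin 2) (Fin 2) ℝ)
    exact (this 0 0).differentiableAt
  have hsq : ∀ x, (M x : Matrix (Fin 2) (Fin 2) ℝ) 0 0 ^ 2 = 1 := by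
    intro x
    obtain ⟨r, hr, e⟩ := hMs x
    rw [e]
    simpa using hr
  have hconst : ∀ x, M x = M 0 := by
    intro x
    have e0 := eq_of_sq_eq_one hMd hsq x 0
    obtain ⟨r, -, e⟩ := hMs x
    obtain ⟨s, -, e'⟩ := hMs 0
    apply Subtype.ext
    rw [e, e'] at e0 ⊢
    have : r = s := by simpa using e0
    rw [this]
  -- `B` is right only up to the sign `M x`; as this sign is the same for all `x`, one correction
  -- serves everywhere.
  refine ⟨B * (M 0)⁻¹, fun x => ?_⟩
  rw [← hconst x]
  simp only [hM, hF]
  group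

/-- The pull-back of the normalized lift by the deck transformation solves the Hill equation
with the same potential. -/
theorem hill_pullback_lift (γ : DevelopingMap κ) :
    (∀ x, deriv (deriv (κ.pullback (-(1 / 2)) γ.lift.1)) x =
      -(γ.potential x * κ.pullback (-(1 / 2)) γ.lift.1 x)) ∧
    ∀ x, deriv (deriv (κ.pullback (-(1 / 2)) γ.lift.2)) x =
      -(γ.potential x * κ.pullback (-(1 / 2)) γ.lift.2 x) := by
  obtain ⟨h, hh⟩ := γ.exists_frame_monodromy
  have h1 := γ.lift_spec.smooth₁
  have h2 := γ.lift_spec.smooth₂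
  -- The monodromy is constant in `x`, so the pulled-back lift is a combination of the lift with
  -- constant coefficients; a linear equation passes to it without computing how the potential
  -- transforms under `κ`.
  have key : ∀ x, jetFrame (κ.pullback (-(1 / 2)) γ.lift.1) (κ.pullback (-(1 / 2)) γ.lift.2) x =
      jetFrame γ.lift.1 γ.lift.2 x * ((h⁻¹ : SL2) : Matrix (Fin 2) (Fin 2) ℝ) := by
    intro x
    rw [jetFrame_pullback κ h1 h2, ← coe_frame, ← coe_frame, ← Matrix.SpecialLinearGroup.coe_mul,
      ← Matrix.SpecialLinearGroup.coe_mul, ← hh x,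
      mul_inv_cancel_right]
  set b := ((h⁻¹ : SL2) : Matrix (Fin 2) (Fin 2) ℝ)
  have lin : ∀ p q : ℝ, ∀ x, deriv (deriv fun y => γ.lift.1 y * p + γ.lift.2 y * q) x =
      -(γ.potential x * (γ.lift.1 x * p + γ.lift.2 x * q)) := by
    intro p q x
    have e1 : deriv (fun y => γ.lift.1 y * p + γ.lift.2 y * q) =
        fun y => deriv γ.lift.1 y * p + deriv γ.lift.2 y * q := funext fun y =>
      (((hasDerivAt_of_contDiff h1 y).mul_const p).add
        ((hasDerivAt_of_contDiff h2 y).mul_const q)).deriv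
    have e2 : deriv (fun y => deriv γ.lift.1 y * p + deriv γ.lift.2 y * q) x = _ :=
      (((hasDerivAt_of_contDiff (contDiff_deriv h1) x).mul_const p).add
        ((hasDerivAt_of_contDiff (contDiff_deriv h2) x).mul_const q)).deriv
    rw [e1, e2, γ.hill_lift.1, γ.hill_lift.2]
    ring
  have k1 : κ.pullback (-(1 / 2)) γ.lift.1 = fun y => γ.lift.1 y * b 0 0 + γ.lift.2 y * b 1 0 := by
    funext y
    have := congrFun (congrFun (key y) 1) 0
    rw [Matrix.mul_apply, Fin.sum_univ_two] at this
    exact this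
  have k2 : κ.pullback (-(1 / 2)) γ.lift.2 = fun y => γ.lift.1 y * b 0 1 + γ.lift.2 y * b 1 1 := by
    funext y
    have := congrFun (congrFun (key y) 1) 1
    rw [Matrix.mul_apply, Fin.sum_univ_two] at this
    exact this
  rw [k1, k2]
  exact ⟨lin _ _, lin _ _⟩

/-- Both sides describe `-ℒ_{κ^* v}` on jets of pulled-back solutions: pull-back commutes with the
Lie derivative, and the pulled-back solutions satisfy the same Hill equation. The frame of solutions
is invertible and can be cancelled. -/
theorem jetMap_mul_lieMatrix (γ : DevelopingMap κ) {v : ℝ → ℝ} (hv : ContDiff ℝ ∞ v) (x : ℝ) :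
    (κ.jetMap x : Matrix (Fin 2) (Fin 2) ℝ) * lieMatrix γ.potential v (κ x) =
      lieMatrix γ.potential (κ.pullback (-1) v) x * κ.jetMap x := by
  have h1 := γ.lift_spec.smooth₁
  have h2 := γ.lift_spec.smooth₂
  have hlie : ∀ {u : ℝ → ℝ}, ContDiff ℝ ∞ u →
      ContDiff ℝ ∞ (fun y => -lieDeriv (-(1 / 2)) v u y) := fun hu =>
    ((hv.mul (contDiff_deriv hu)).add ((contDiff_const.mul (contDiff_deriv hv)).mul hu)).neg
  have e1 := jetFrame_neg_lieDeriv hv h1 h2 γ.hill_lift.1 γ.hill_lift.2 (κ x)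
  have e2 := jetFrame_neg_lieDeriv (contDiff_pullback κ (-1) hv) (contDiff_pullback κ _ h1)
    (contDiff_pullback κ _ h2) γ.hill_pullback_lift.1 γ.hill_pullback_lift.2 x
  have e3 := jetFrame_pullback κ (hlie h1) (hlie h2) x
  rw [funext (pullback_lieDeriv κ hv h1), funext (pullback_lieDeriv κ hv h2), e1, e2,
    jetFrame_pullback κ h1 h2, ← coe_frame, ← mul_assoc, ← mul_assoc] at e3
  have e4 := congrArg (· * (((γ.frame (κ x))⁻¹ : SL2) : Matrix (Fin 2) (Fin 2) ℝ)) e3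
  simp only [mul_assoc, coe_mul_coe_inv, mul_one] at e4
  exact e4.symm

/-! ### The forms along the embedding -/

/-- Provides representatives in `SL2` that are differentiable in `t` and agree at `t = 0` with the
chosen frame, as needed to evaluate the Maurer-Cartan form. -/
theorem exists_frame_curve {c : ℝ → DevelopingMap κ} (hc : IsSmoothCurve c) :
    ∃ G : ℝ → ℝ → SL2, (∀ t x, iotaHat (c t) x = (G t x : PSL2)) ∧
      (∀ x, G 0 x = (c 0).frame x) ∧
      ∀ x, HasEntryDerivAt (fun t => (G t x : Matrix (Fin 2) (Fin 2) ℝ))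
        (lieMatrix (c 0).potential (theta c) x * (c 0).frame x) 0 := by
  have h1 := (c 0).lift_spec.smooth₁
  have h2 := (c 0).lift_spec.smooth₂
  obtain ⟨U₁, U₂, hU₁, hU₂, hl, e1, e2, d1, d2⟩ :=
    exists_smooth_lift_of_isNormalizedLift hc (c 0).lift_spec
  refine ⟨fun t x => (hl t).frame x, fun t x => (hl t).frame_eq (c t).lift_spec x, fun x => ?_,
    fun x => ?_⟩
  · apply Subtype.ext
    rw [IsNormalizedLift.coe_frame, coe_frame, funext e1, funext e2]
  · rw [coe_frame, ← jetFrame_neg_lieDeriv (contDiff_theta hc) h1 h2 (c 0).hill_lift.1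
      (c 0).hill_lift.2, ← funext d1, ← funext d2]
    intro i j
    fin_cases i <;> fin_cases j
    · exact hasDerivAt_deriv_right hU₁ 0 x
    · exact hasDerivAt_deriv_right hU₂ 0 x
    · exact (hasDerivAt_comp_prodMk_left hU₁ 0 x).differentiableAt.hasDerivAt
    · exact (hasDerivAt_comp_prodMk_left hU₂ 0 x).differentiableAt.hasDerivAt

theorem xi_iotaHat {c : ℝ → DevelopingMap κ} (hc : IsSmoothCurve c) (x : ℝ) :
    QuasiPeriodicSection.xi (fun t => iotaHat (c t)) x =
      (((c 0).frame x)⁻¹ : SL2) * lieMatrix (c 0).potential (theta c) x * (c 0).frame x := by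
  obtain ⟨G, hG, h0, hd⟩ := exists_frame_curve hc
  unfold QuasiPeriodicSection.xi
  rw [maurerCartan_eq_of_hasEntryDerivAt (fun t => hG t x) (hd x), h0, mul_assoc]

/-- The derivatives of `g⁻¹` and `g` contribute `-[a, A_v]` inside the conjugation, which cancels
the commutator in the derivative of `A_v`; only the entry `-D_L v` survives. -/
theorem hasEntryDerivAt_xi_iotaHat {c : ℝ → DevelopingMap κ} (hc : IsSmoothCurve c) (x : ℝ) :
    HasEntryDerivAt (QuasiPeriodicSection.xi (fun t => iotaHat (c t)))
      ((((c 0).frame x)⁻¹ : SL2) * !![0, -hillD (c 0).potential (theta c) x; 0, 0] *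
        (c 0).frame x) x := by
  rw [funext (xi_iotaHat hc)]
  have hg := (c 0).hasEntryDerivAt_frame x
  have h := (hg.inv.mul
    (hasEntryDerivAt_lieMatrix (c 0).contDiff_potential (contDiff_theta hc) x)).mul hg
  convert h using 1
  simp only [mul_add, add_mul, mul_sub, sub_mul, neg_mul, mul_assoc]
  rw [← mul_assoc ((c 0).frame x : Matrix (Fin 2) (Fin 2) ℝ), coe_mul_coe_inv, one_mul]
  abel

theorem xiDeriv_iotaHat {c : ℝ → DevelopingMap κ} (hc : IsSmoothCurve c) (x : ℝ) :
    QuasiPeriodicSection.xiDeriv (fun t => iotaHat (c t)) x =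
      (((c 0).frame x)⁻¹ : SL2) * !![0, -hillD (c 0).potential (theta c) x; 0, 0] *
        (c 0).frame x := by
  ext i j
  exact (hasEntryDerivAt_xi_iotaHat hc x i j).deriv

/-- In the representative `g(κ x)⁻¹ J⁻¹ g(x)` the factor `g(x)` contributes `A_v(x)`, and `g(κ x)⁻¹`
contributes `-J A_v(κ x) J⁻¹ = -A_{κ^* v}(x)`. The point `x` is arbitrary, so it can be matched with
any base point. -/
theorem monodromyForm_iotaHat {c : ℝ → DevelopingMap κ} (hc : IsSmoothCurve c) (x : ℝ) :
    QuasiPeriodicSection.monodromyForm (fun t => iotaHat (c t)) =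
      (((c 0).frame x)⁻¹ : SL2) * (lieMatrix (c 0).potential (theta c) x -
        lieMatrix (c 0).potential (κ.pullback (-1) (theta c)) x) * (c 0).frame x := by
  obtain ⟨G, hG, h0, hd⟩ := exists_frame_curve hc
  set J := κ.jetMap x
  have hm : ∀ t, (iotaHat (c t)).monodromy =
      (((G t (κ x))⁻¹ * J⁻¹ * G t x : SL2) : PSL2) := by
    intro t
    have := (iotaHat (c t)).quasiPeriodic.choose_spec x
    rw [hG, hG] at this
    change _ = _ * (iotaHat (c t)).monodromy⁻¹ at this
    rw [QuotientGroup.mk_mul, QuotientGroup.mk_mul, QuotientGroup.mk_inv, QuotientGroup.mk_inv,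
      ← mul_inv_rev, this]
    group
  have hder := ((hd (κ x)).inv.mul_const ((J⁻¹ : SL2) : Matrix (Fin 2) (Fin 2) ℝ)).mul (hd x)
  unfold QuasiPeriodicSection.monodromyForm
  rw [maurerCartan_eq_of_hasEntryDerivAt hm hder]
  have hJ := (c 0).jetMap_mul_lieMatrix (contDiff_theta hc) x
  have hJ' : (J : Matrix (Fin 2) (Fin 2) ℝ) *
      (lieMatrix (c 0).potential (theta c) (κ x) * ((J⁻¹ : SL2) : Matrix (Fin 2) (Fin 2) ℝ)) =
      lieMatrix (c 0).potential (κ.pullback (-1) (theta c)) x := by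
    rw [← mul_assoc, hJ, mul_assoc, coe_mul_coe_inv, mul_one]
  simp only [h0, mul_inv_rev, inv_inv, Matrix.SpecialLinearGroup.coe_mul]
  set g := (c 0).frame x
  set k := (c 0).frame (κ x)
  have c1 : ∀ (a : SL2) (X : Matrix (Fin 2) (Fin 2) ℝ),
      (a : Matrix (Fin 2) (Fin 2) ℝ) * (((a⁻¹ : SL2) : Matrix (Fin 2) (Fin 2) ℝ) * X) = X :=
    fun a X => by rw [← mul_assoc, coe_mul_coe_inv, one_mul]
  rw [← hJ']
  simp only [mul_add, mul_sub, sub_mul, neg_mul, mul_neg, mul_assoc, c1]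
  abel

/-- The difference on the right is `g⁻¹ A_{κ^* v} g` at `x`; the relation `J g(κ x) h = g(x)` and
the intertwining by `J` carry it to `κ x`. -/
theorem xi_iotaHat_apply_deck {c : ℝ → DevelopingMap κ} (hc : IsSmoothCurve c) {h : SL2}
    (hh : ∀ x, κ.jetMap x * (c 0).frame (κ x) * h = (c 0).frame x) (x : ℝ) :
    QuasiPeriodicSection.xi (fun t => iotaHat (c t)) (κ x) =
      h * (QuasiPeriodicSection.xi (fun t => iotaHat (c t)) x -
        QuasiPeriodicSection.monodromyForm (fun t => iotaHat (c t))) * (h⁻¹ : SL2) := by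
  rw [xi_iotaHat hc, xi_iotaHat hc, monodromyForm_iotaHat hc x, ← sub_mul, ← mul_sub,
    sub_sub_cancel]
  have e : (c 0).frame (κ x) = (κ.jetMap x)⁻¹ * (c 0).frame x * h⁻¹ := by
    rw [← hh x]
    group
  have hJ := (c 0).jetMap_mul_lieMatrix (contDiff_theta hc) x
  rw [e]
  simp only [mul_inv_rev, inv_inv, Matrix.SpecialLinearGroup.coe_mul]
  set J := κ.jetMap x
  have c1 : ∀ (a : SL2) (X : Matrix (Fin 2) (Fin 2) ℝ),
      (a : Matrix (Fin 2) (Fin 2) ℝ) * (((a⁻¹ : SL2) : Matrix (Fin 2) (Fin 2) ℝ) * X) = X :=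
    fun a X => by rw [← mul_assoc, coe_mul_coe_inv, one_mul]
  have hJ' : ∀ X : Matrix (Fin 2) (Fin 2) ℝ, (J : Matrix (Fin 2) (Fin 2) ℝ) *
      (lieMatrix (c 0).potential (theta c) (κ x) * X) =
      lieMatrix (c 0).potential (κ.pullback (-1) (theta c)) x * (J * X) := fun X => by
    rw [← mul_assoc, hJ, mul_assoc]
  simp only [mul_assoc, hJ', c1]

/-- The two forms agree if they are computed with the same base point. -/
theorem varpi_eq_varpi_iotaHat (x : ℝ) {c₁ c₂ : ℝ → DevelopingMap κ} (h₁ : IsSmoothCurve c₁)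
    (h₂ : IsSmoothCurve c₂) (h0 : c₁ 0 = c₂ 0) :
    varpi x c₁ c₂ = QuasiPeriodicSection.varpi x (fun t => iotaHat (c₁ t))
      (fun t => iotaHat (c₂ t)) := by
  unfold QuasiPeriodicSection.varpi varpi
  simp only [xi_iotaHat h₁, xi_iotaHat h₂, xiDeriv_iotaHat h₁, xiDeriv_iotaHat h₂,
    monodromyForm_iotaHat h₁ x, monodromyForm_iotaHat h₂ x, ← h0, metric_conj_inv,
    metric_lieMatrix_single]
  congr 1
  -- The factor `-1/2` meets the `2` of `metric_lieMatrix_single`, and its sign reverses the order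
  -- of the two terms.
  · rw [← intervalIntegral.integral_const_mul]
    congr 1
    funext y
    ring
  -- The two copies of `⟨A_{v₁}, A_{v₂}⟩` cancel by symmetry. Each remaining pairing enters with a
  -- minus sign and the factor `1/2`, which the `-2` of `metric_lieMatrix` absorbs.
  · rw [metric_comm, metric_comm (lieMatrix _ (theta c₂) x), metric_sub_left, metric_sub_left,
      metric_comm (lieMatrix _ (κ.pullback (-1) (theta c₂)) x),
      metric_comm (lieMatrix _ (κ.pullback (-1) (theta c₁)) x),
      metric_comm (lieMatrix _ (theta c₂) x) (lieMatrix _ (theta c₁) x),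
      metric_lieMatrix _ _ (κ.pullback _ _), metric_lieMatrix _ _ (κ.pullback _ _)]
    ring

theorem varpi_iotaHat_baseChange (x y : ℝ) {c₁ c₂ : ℝ → DevelopingMap κ} (h₁ : IsSmoothCurve c₁)
    (h₂ : IsSmoothCurve c₂) (h0 : c₁ 0 = c₂ 0) :
    QuasiPeriodicSection.varpi x (fun t => iotaHat (c₁ t)) (fun t => iotaHat (c₂ t)) =
      QuasiPeriodicSection.varpi y (fun t => iotaHat (c₁ t)) (fun t => iotaHat (c₂ t)) := by
  -- Both curves start at the same developing map, so one `h` serves for the equivariance of both.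
  obtain ⟨h, hh⟩ := (c₁ 0).exists_frame_monodromy
  refine baseChange_eq κ h (fun x => ?_) (fun x => ?_) (xi_iotaHat_apply_deck h₁ hh)
    (xi_iotaHat_apply_deck h₂ (h0 ▸ hh)) ?_ x y
  · rw [xiDeriv_iotaHat h₁]
    exact hasEntryDerivAt_xi_iotaHat h₁ x
  · rw [xiDeriv_iotaHat h₂]
    exact hasEntryDerivAt_xi_iotaHat h₂ x
  · simp only [xi_iotaHat h₁, xi_iotaHat h₂, xiDeriv_iotaHat h₁, xiDeriv_iotaHat h₂, ← h0,
      metric_conj_inv, metric_lieMatrix_single]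
    have hD : ∀ {v : ℝ → ℝ}, ContDiff ℝ ∞ v → Continuous (hillD (c₁ 0).potential v) := by
      intro v hv
      have hT := (c₁ 0).contDiff_potential
      unfold hillD
      rw [iteratedDeriv_three_eq]
      exact ((((contDiff_deriv hT).mul hv).add ((contDiff_const.mul hT).mul
        (contDiff_deriv hv))).add (contDiff_const.mul
          (contDiff_deriv (contDiff_deriv (contDiff_deriv hv))))).neg.continuous
    have hv₁ := contDiff_theta h₁
    have hv₂ := contDiff_theta h₂
    exact (continuous_const.mul (hv₁.continuous.mul (hD hv₂))).sub
      (continuous_const.mul (hv₂.continuous.mul (hD hv₁)))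

end DevelopingMap

end DrinfeldSokolov

end

theorem mainTheorem4 (κ : DrinfeldSokolov.Deck) :
    (∀ c : ℝ → DrinfeldSokolov.DevelopingMap κ, DrinfeldSokolov.DevelopingMap.IsSmoothCurve c →
      DrinfeldSokolov.QuasiPeriodicSection.IsSmoothCurve
        (fun t => DrinfeldSokolov.iotaHat (c t))) ∧
    (∀ x₀ x₁ : ℝ, ∀ c₁ c₂ : ℝ → DrinfeldSokolov.DevelopingMap κ,
      DrinfeldSokolov.DevelopingMap.IsSmoothCurve c₁ →
      DrinfeldSokolov.DevelopingMap.IsSmoothCurve c₂ →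
      c₁ 0 = c₂ 0 →
      DrinfeldSokolov.DevelopingMap.varpi x₀ c₁ c₂ =
        DrinfeldSokolov.QuasiPeriodicSection.varpi x₁
          (fun t => DrinfeldSokolov.iotaHat (c₁ t)) (fun t => DrinfeldSokolov.iotaHat (c₂ t))) := by
  refine ⟨fun c hc => DrinfeldSokolov.isSmoothCurve_iotaHat hc, fun x₀ x₁ c₁ c₂ h₁ h₂ h0 => ?_⟩
  -- The forms are compared at `x₀`, and then the base point of `ϖ_𝒫` is moved to `x₁`.
  rw [DrinfeldSokolov.DevelopingMap.varpi_eq_varpi_iotaHat x₀ h₁ h₂ h0]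
  exact DrinfeldSokolov.DevelopingMap.varpi_iotaHat_baseChange x₀ x₁ h₁ h₂ h0
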